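/- Let $K$ be a field, and let $\Delta_1$ and $\Delta_2$ be simplicial complexes on disjoint finite vertex sets $V_1$ and $V_2$ (a simplicial complex on $V$ is a family of subsets of $V$, its faces, that contains $\emptyset$ and is closed under taking subsets; not every $v\in V$ has to be a face $\{v\}$). Their join $\Delta_1*\Delta_2$ is the simplicial complex on $V_1\cup V_2$ with faces $\{F_1\cup F_2 : F_1\in\Delta_1,\ F_2\in\Delta_2\}$. For a simplicial complex $\Delta$ on a finite set $V$, let $R=K[V]$ be the polynomial ring on the vertices with its standard grading, let $K[\Delta]=R/I_\Delta$ be the Stanley--Reisner ring, where $I_\Delta$ is the ideal generated by the monomials $\prod_{v\in s}v$ with $s\subseteq V$ not a face of $\Delta$, and let $\beta_{i,d}^K(\Delta)$ be the rank of $R(-d)$ in the $i$-th module of a minimal graded free resolution of $K[\Delta]$ over $R$. Then for all integers $i,d\ge 0$ $$\beta_{i,d}^K(\Delta_1 * \Delta_2)=\sum_{p+q=i}\ \sum_{r+s=d}\beta_{p,r}^K(\Delta_1)\,\beta_{q,s}^K(\Delta_2),$$ where $p,q,r,s$ range over nonnegative integers. -/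

import Mathlib

namespace BettiJoin

open MvPolynomial

universe u v w

/-! ### Simplicial complexes, joins and Stanley-Reisner ideals -/

section Complexes

variable {V : Type u} {V₁ : Type u} {V₂ : Type v}

/-- The faces of a simplicial complex on the vertex set `V`, the empty face included. (The
underlying Mathlib structure records the nonempty faces only; it does not require that each vertex
is a face.) -/
def IsFace (Δ : PreAbstractSimplicialComplex V) (s : Finset V) : Prop :=
  s = ∅ ∨ s ∈ Δ

theorem IsFace.mono {Δ : PreAbstractSimplicialComplex V} {s t : Finset V}
    (hs : IsFace Δ s) (hts : t ⊆ s) : IsFace Δ t := by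
  rcases t.eq_empty_or_nonempty with ht | ht
  · exact Or.inl ht
  · rcases hs with rfl | hs
    · exact Or.inl (Finset.subset_empty.mp hts)
    · exact Or.inr ((Δ.isRelLowerSet_faces hs).2 hts ht)

/-- The join of two simplicial complexes with disjoint vertex sets `V₁` and `V₂`: its vertex set is
the disjoint union of `V₁` and `V₂`, and its faces are the unions of a face of `Δ₁` with a face of
`Δ₂` (both possibly empty). -/
def join (Δ₁ : PreAbstractSimplicialComplex V₁) (Δ₂ : PreAbstractSimplicialComplex V₂) :
    PreAbstractSimplicialComplex (V₁ ⊕ V₂) where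
  faces := {s | s.Nonempty ∧ ∃ F₁ F₂, IsFace Δ₁ F₁ ∧ IsFace Δ₂ F₂ ∧ s = F₁.disjSum F₂}
  isRelLowerSet_faces := by
    rintro s ⟨hs, F₁, F₂, h₁, h₂, rfl⟩
    refine ⟨hs, fun t hts ht => ⟨ht, t.toLeft, t.toRight, h₁.mono ?_, h₂.mono ?_,
      Finset.toLeft_disjSum_toRight.symm⟩⟩
    · exact (Finset.subset_disjSum.mp hts).1
    · exact (Finset.subset_disjSum.mp hts).2

/-- The Stanley-Reisner ideal of `Δ` in the polynomial ring on the vertex set: it is generated by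
the products of the vertices in the sets that are not faces. The Stanley-Reisner ring `K[Δ]` is the
quotient by it. -/
noncomputable def stanleyReisnerIdeal (K : Type w) [Field K] (Δ : PreAbstractSimplicialComplex V) :
    Ideal (MvPolynomial V K) :=
  Ideal.span {f | ∃ s : Finset V, ¬ IsFace Δ s ∧ f = ∏ v ∈ s, X v}

end Complexes

/-! ### Minimal graded free resolutions and Betti numbers -/

section Resolutions

variable {V : Type u} {K : Type w} [Field K]

/-- For `F = ⨁ⱼ R(-dⱼ)`, with `R = K[V]` standard graded and `d = deg`, the element `x` of `F` is
homogeneous of degree `n`: the `j`-th coordinate is zero or is homogeneous of degree `n - dⱼ`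
(where `dⱼ ≤ n`). -/
def IsHomogeneousVec {ι : Type} (deg : ι → ℕ) (n : ℕ) (x : ι → MvPolynomial V K) : Prop :=
  ∀ j, x j = 0 ∨ ∃ m, m + deg j = n ∧ (x j).IsHomogeneous m

/-- A minimal graded free resolution of `R ⧸ I` by finite free modules, where `R = K[V]` is standard
graded. The `i`-th module is `Fᵢ = ⨁ R(-deg i j)`, the sum over the finite type `gen i`. The maps
are homogeneous of degree zero, and minimality says that the image of `Fᵢ₊₁` lies in `𝔪 Fᵢ`, with
`𝔪` the ideal generated by the variables. -/
structure MinimalGradedFreeResolution (I : Ideal (MvPolynomial V K)) where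
  gen : ℕ → Type
  finite_gen : ∀ i, Finite (gen i)
  deg : ∀ i, gen i → ℕ
  diff : ∀ i, (gen (i + 1) → MvPolynomial V K) →ₗ[MvPolynomial V K] (gen i → MvPolynomial V K)
  aug : (gen 0 → MvPolynomial V K) →ₗ[MvPolynomial V K] (MvPolynomial V K ⧸ I)
  diff_graded : ∀ i n x, IsHomogeneousVec (deg (i + 1)) n x → IsHomogeneousVec (deg i) n (diff i x)
  aug_graded : ∀ n x, IsHomogeneousVec (deg 0) n x →
    ∃ f : MvPolynomial V K, f.IsHomogeneous n ∧ aug x = Ideal.Quotient.mk I f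
  aug_surjective : Function.Surjective aug
  exact_aug : Function.Exact (diff 0) aug
  exact_diff : ∀ i, Function.Exact (diff (i + 1)) (diff i)
  minimal : ∀ i x j, diff i x j ∈ idealOfVars V K

/-- The rank of `R(-d)` in the `i`-th module of the resolution. -/
noncomputable def MinimalGradedFreeResolution.betti {I : Ideal (MvPolynomial V K)}
    (F : MinimalGradedFreeResolution I) (i d : ℕ) : ℕ :=
  Nat.card {j : F.gen i // F.deg i j = d}

/-! #### Existence of minimal graded free resolutions -/

theorem mem_idealOfVars_iff (p : MvPolynomial V K) :
    p ∈ idealOfVars V K ↔ constantCoeff p = 0 := by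
  have h := mem_pow_idealOfVars_iff' (σ := V) (R := K) 1 p
  rw [pow_one] at h
  rw [h]
  constructor
  · intro h
    exact h 0 (by simp)
  · intro h x hx
    have : x = 0 := by simpa [Finsupp.degree_eq_zero_iff] using hx
    rw [this]; exact h

/-- The homogeneous component of degree `n` of an element of `⨁ⱼ R(-dⱼ)`. -/
noncomputable def comp {ι : Type} (deg : ι → ℕ) (n : ℕ) (x : ι → MvPolynomial V K) :
    ι → MvPolynomial V K :=
  fun j => if deg j ≤ n then homogeneousComponent (n - deg j) (x j) else 0

theorem comp_homogeneous {ι : Type} (deg : ι → ℕ) (n : ℕ) (x : ι → MvPolynomial V K) :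
    IsHomogeneousVec deg n (comp deg n x) := by
  intro j
  by_cases h : deg j ≤ n
  · right
    refine ⟨n - deg j, by omega, ?_⟩
    simp only [comp, if_pos h]
    exact homogeneousComponent_isHomogeneous _ _
  · left; simp [comp, h]

theorem comp_add {ι : Type} (deg : ι → ℕ) (n : ℕ) (x y : ι → MvPolynomial V K) :
    comp deg n (x + y) = comp deg n x + comp deg n y := by
  funext j
  by_cases h : deg j ≤ n <;> simp [comp, h]

theorem comp_zero {ι : Type} (deg : ι → ℕ) (n : ℕ) :
    comp deg n (0 : ι → MvPolynomial V K) = 0 := by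
  funext j
  by_cases h : deg j ≤ n <;> simp [comp, h]

theorem comp_sum {ι κ : Type} (deg : ι → ℕ) (n : ℕ) (s : Finset κ)
    (x : κ → ι → MvPolynomial V K) :
    comp deg n (∑ k ∈ s, x k) = ∑ k ∈ s, comp deg n (x k) := by
  classical
  induction s using Finset.induction_on with
  | empty => simp [comp_zero]
  | insert a s ha ih => rw [Finset.sum_insert ha, Finset.sum_insert ha, comp_add, ih]

theorem comp_of_homogeneous {ι : Type} {deg : ι → ℕ} {m : ℕ} {x : ι → MvPolynomial V K}
    (hx : IsHomogeneousVec deg m x) (n : ℕ) : comp deg n x = if m = n then x else 0 := by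
  funext j
  rcases hx j with h | ⟨k, hk, h⟩
  · by_cases h1 : deg j ≤ n <;> by_cases h2 : m = n <;> simp [comp, h, h1, h2]
  · by_cases h1 : deg j ≤ n
    · simp only [comp, if_pos h1]
      rw [homogeneousComponent_of_mem ((mem_homogeneousSubmodule _ _).mpr h)]
      by_cases h2 : m = n
      · rw [if_pos h2, if_pos (by omega)]
      · rw [if_neg h2, if_neg (by omega)]; rfl
    · have : ¬ m = n := by omega
      simp [comp, h1, this]

theorem sum_comp {ι : Type} [Finite ι] (deg : ι → ℕ) (x : ι → MvPolynomial V K) :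
    ∃ N, ∑ n ∈ Finset.range N, comp deg n x = x := by
  classical
  cases nonempty_fintype ι
  have key : ∀ j, ∃ N0, ∀ N, N0 ≤ N → ∑ n ∈ Finset.range N, comp deg n x j = x j := by
    intro j
    refine ⟨deg j + ((x j).totalDegree + 1), fun N hN => ?_⟩
    obtain ⟨M, rfl⟩ := Nat.exists_eq_add_of_le (show deg j ≤ N by omega)
    rw [Finset.sum_range_add]
    have h0 : ∑ n ∈ Finset.range (deg j), comp deg n x j = 0 := by
      refine Finset.sum_eq_zero fun n hn => ?_
      have := Finset.mem_range.mp hn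
      simp [comp, show ¬ deg j ≤ n by omega]
    rw [h0, zero_add]
    have h1 : ∀ n ∈ Finset.range M, comp deg (deg j + n) x j = homogeneousComponent n (x j) := by
      intro n _
      simp [comp]
    rw [Finset.sum_congr rfl h1]
    obtain ⟨L, rfl⟩ := Nat.exists_eq_add_of_le (show (x j).totalDegree + 1 ≤ M by omega)
    rw [Finset.sum_range_add, sum_homogeneousComponent]
    simp only [add_eq_left]
    refine Finset.sum_eq_zero fun n _ => ?_
    exact homogeneousComponent_eq_zero _ _ (by omega)
  choose N0 hN0 using key
  refine ⟨Finset.univ.sup N0, ?_⟩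
  funext j
  rw [Finset.sum_apply]
  exact hN0 j _ (Finset.le_sup (Finset.mem_univ j))

/-- A homomorphism of graded free modules that is homogeneous of degree zero. -/
def IsGradedMap {ι κ : Type} (deg : ι → ℕ) (deg' : κ → ℕ)
    (φ : (ι → MvPolynomial V K) →ₗ[MvPolynomial V K] (κ → MvPolynomial V K)) : Prop :=
  ∀ n x, IsHomogeneousVec deg n x → IsHomogeneousVec deg' n (φ x)

theorem IsGradedMap.comp_apply {ι κ : Type} [Finite ι] {deg : ι → ℕ} {deg' : κ → ℕ}
    {φ : (ι → MvPolynomial V K) →ₗ[MvPolynomial V K] (κ → MvPolynomial V K)}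
    (hφ : IsGradedMap deg deg' φ) (n : ℕ) (x : ι → MvPolynomial V K) :
    φ (comp deg n x) = comp deg' n (φ x) := by
  classical
  obtain ⟨N, hN⟩ := sum_comp deg x
  by_cases hn : n < N
  · conv_rhs => rw [← hN, map_sum, comp_sum]
    rw [Finset.sum_eq_single n]
    · rw [comp_of_homogeneous (hφ n _ (comp_homogeneous deg n x)), if_pos rfl]
    · intro b _ hb
      rw [comp_of_homogeneous (hφ b _ (comp_homogeneous deg b x)), if_neg hb]
    · intro h; exact absurd (Finset.mem_range.mpr hn) h
  · have h1 : comp deg n x = 0 := by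
      conv_lhs => rw [← hN, comp_sum]
      refine Finset.sum_eq_zero fun b hb => ?_
      have := Finset.mem_range.mp hb
      rw [comp_of_homogeneous (comp_homogeneous deg b x), if_neg (by omega)]
    rw [h1, map_zero]
    conv_rhs => rw [← hN, map_sum, comp_sum]
    refine (Finset.sum_eq_zero fun b hb => ?_).symm
    have := Finset.mem_range.mp hb
    rw [comp_of_homogeneous (hφ b _ (comp_homogeneous deg b x)), if_neg (by omega)]

/-- A submodule of a graded free module that contains the homogeneous components of its elements. -/
def IsGradedSubmodule {ι : Type} (deg : ι → ℕ)
    (N : Submodule (MvPolynomial V K) (ι → MvPolynomial V K)) : Prop :=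
  ∀ x ∈ N, ∀ n, comp deg n x ∈ N

theorem IsGradedMap.ker {ι κ : Type} [Finite ι] {deg : ι → ℕ} {deg' : κ → ℕ}
    {φ : (ι → MvPolynomial V K) →ₗ[MvPolynomial V K] (κ → MvPolynomial V K)}
    (hφ : IsGradedMap deg deg' φ) : IsGradedSubmodule deg (LinearMap.ker φ) := by
  intro x hx n
  rw [LinearMap.mem_ker] at hx ⊢
  rw [hφ.comp_apply, hx, comp_zero]

theorem IsHomogeneousVec.zero {ι : Type} (deg : ι → ℕ) (n : ℕ) :
    IsHomogeneousVec deg n (0 : ι → MvPolynomial V K) := fun _ => Or.inl rfl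

theorem IsHomogeneousVec.add {ι : Type} {deg : ι → ℕ} {n : ℕ} {x y : ι → MvPolynomial V K}
    (hx : IsHomogeneousVec deg n x) (hy : IsHomogeneousVec deg n y) :
    IsHomogeneousVec deg n (x + y) := by
  intro j
  rcases hx j with h | ⟨m, hm, h⟩ <;> rcases hy j with h' | ⟨m', hm', h'⟩
  · left; simp [h, h']
  · right; exact ⟨m', hm', by simpa [h] using h'⟩
  · right; exact ⟨m, hm, by simpa [h'] using h⟩
  · right
    obtain rfl : m = m' := by omega
    exact ⟨m, hm, h.add h'⟩

theorem IsHomogeneousVec.sum {ι κ : Type} {deg : ι → ℕ} {n : ℕ} (s : Finset κ)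
    {x : κ → ι → MvPolynomial V K} (hx : ∀ k ∈ s, IsHomogeneousVec deg n (x k)) :
    IsHomogeneousVec deg n (∑ k ∈ s, x k) := by
  classical
  induction s using Finset.induction_on with
  | empty => simpa using IsHomogeneousVec.zero deg n
  | insert a s ha ih =>
    rw [Finset.sum_insert ha]
    exact (hx a (Finset.mem_insert_self a s)).add
      (ih fun k hk => hx k (Finset.mem_insert_of_mem hk))

theorem IsHomogeneousVec.smul {ι : Type} {deg : ι → ℕ} {m n : ℕ} {x : ι → MvPolynomial V K}
    (hx : IsHomogeneousVec deg n x) {p : MvPolynomial V K} (hp : p.IsHomogeneous m) :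
    IsHomogeneousVec deg (m + n) (p • x) := by
  intro j
  rcases hx j with h | ⟨k, hk, h⟩
  · left; simp [h]
  · right; exact ⟨m + k, by omega, by simpa using hp.mul h⟩

/-- A graded submodule of a finite graded free module has a finite family of homogeneous
generators; the map from the free module on a shortest such family has its kernel in `𝔪` times that
module. -/
theorem exists_minimal_cover [Finite V] {ι : Type} [Finite ι] (deg : ι → ℕ)
    (N : Submodule (MvPolynomial V K) (ι → MvPolynomial V K)) (hN : IsGradedSubmodule deg N) :
    ∃ (k : ℕ) (deg' : Fin k → ℕ)
      (φ : (Fin k → MvPolynomial V K) →ₗ[MvPolynomial V K] (ι → MvPolynomial V K)),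
      IsGradedMap deg' deg φ ∧ LinearMap.range φ = N ∧
        ∀ x ∈ LinearMap.ker φ, ∀ j, x j ∈ idealOfVars V K := by
  classical
  let P : ℕ → Prop := fun k => ∃ (g : Fin k → ι → MvPolynomial V K) (e : Fin k → ℕ),
    (∀ a, IsHomogeneousVec deg (e a) (g a)) ∧ Submodule.span (MvPolynomial V K) (Set.range g) = N
  have hP : ∃ k, P k := by
    have hspan : Submodule.span (MvPolynomial V K)
        {x | x ∈ N ∧ ∃ n, IsHomogeneousVec deg n x} = N := by
      apply le_antisymm
      · rw [Submodule.span_le]; exact fun x hx => hx.1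
      · intro x hx
        obtain ⟨M, hM⟩ := sum_comp deg x
        rw [← hM]
        exact Submodule.sum_mem _ fun n _ =>
          Submodule.subset_span ⟨hN x hx n, n, comp_homogeneous deg n x⟩
    have hfg := (Submodule.fg_span_iff_fg_span_finset_subset (R := MvPolynomial V K)
      {x | x ∈ N ∧ ∃ n, IsHomogeneousVec deg n x}).mp (by
        rw [hspan]; exact IsNoetherian.noetherian N)
    obtain ⟨s, hs, hs'⟩ := hfg
    rw [hspan] at hs'
    have hdeg : ∀ a : s, ∃ n, IsHomogeneousVec deg n a.1 := fun a => (hs a.2).2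
    choose e he using hdeg
    refine ⟨s.card, fun a => (s.equivFin.symm a).1, fun a => e (s.equivFin.symm a),
      fun a => he _, ?_⟩
    rw [hs']
    congr 1
    ext x
    constructor
    · rintro ⟨a, rfl⟩; exact (s.equivFin.symm a).2
    · intro hx; exact ⟨s.equivFin ⟨x, hx⟩, by simp⟩
  obtain ⟨g, e, hge, hg⟩ := Nat.find_spec hP
  have hmin : ∀ k, P k → Nat.find hP ≤ k := fun k hk => Nat.find_min' hP hk
  generalize Nat.find hP = k at g e hge hg hmin
  let φ : (Fin k → MvPolynomial V K) →ₗ[MvPolynomial V K] (ι → MvPolynomial V K) :=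
    Fintype.linearCombination (MvPolynomial V K) g
  have hφ : ∀ x, φ x = ∑ a, x a • g a := fun x => Fintype.linearCombination_apply _ _ _
  have hgr : IsGradedMap e deg φ := by
    intro n x hx
    rw [hφ]
    refine IsHomogeneousVec.sum _ fun a _ => ?_
    rcases hx a with h | ⟨m, hm, h⟩
    · rw [h, zero_smul]; exact IsHomogeneousVec.zero deg n
    · rw [← hm]; exact (hge a).smul h
  refine ⟨k, e, φ, hgr, ?_, ?_⟩
  · rw [← hg]; exact Fintype.range_linearCombination _ _
  · intro x hx j
    rw [mem_idealOfVars_iff]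
    by_contra hne
    have hker := hgr.ker x hx (e j)
    set y := comp e (e j) x with hy
    have hyj : y j = C (constantCoeff (x j)) := by
      simp [hy, comp, homogeneousComponent_zero, constantCoeff_eq]
    rw [LinearMap.mem_ker, hφ, ← Finset.add_sum_erase _ _ (Finset.mem_univ j), hyj] at hker
    have hgj : g j = (C (constantCoeff (x j))⁻¹ : MvPolynomial V K) • (- ∑ a ∈ Finset.univ.erase j, y a • g a) := by
      rw [← eq_neg_of_add_eq_zero_left hker, smul_smul, ← C_mul, inv_mul_cancel₀ hne, C_1, one_smul]
    have hkpos : 0 < k := j.pos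
    obtain ⟨k', rfl⟩ : ∃ k', k = k' + 1 := ⟨k - 1, by omega⟩
    have : P k' := by
      refine ⟨fun a => g (j.succAbove a), fun a => e (j.succAbove a), fun a => hge _, ?_⟩
      rw [← hg]
      apply le_antisymm
      · apply Submodule.span_mono
        rintro _ ⟨a, rfl⟩
        exact ⟨_, rfl⟩
      · rw [Submodule.span_le]
        have hmem : ∀ a, a ≠ j → g a ∈ Submodule.span (MvPolynomial V K)
            (Set.range fun a => g (j.succAbove a)) := by
          intro a ha
          obtain ⟨b, rfl⟩ := Fin.exists_succAbove_eq ha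
          exact Submodule.subset_span ⟨b, rfl⟩
        rintro _ ⟨a, rfl⟩
        by_cases ha : a = j
        · subst ha
          rw [hgj]
          refine Submodule.smul_mem _ _ (Submodule.neg_mem _ (Submodule.sum_mem _ fun b hb => ?_))
          exact Submodule.smul_mem _ _ (hmem b (Finset.ne_of_mem_erase hb))
        · exact hmem a ha
    have := hmin k' this
    omega

/-- One stage in the construction of a resolution: a finite graded free module with a graded
submodule contained in `𝔪` times it. -/
structure Stage (V : Type u) (K : Type w) [Field K] where
  gen : Type
  fin : Finite gen
  deg : gen → ℕ
  N : Submodule (MvPolynomial V K) (gen → MvPolynomial V K)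
  graded : IsGradedSubmodule deg N
  small : ∀ x ∈ N, ∀ j, x j ∈ idealOfVars V K

theorem Stage.exists_next [Finite V] (S : Stage V K) :
    ∃ (T : Stage V K)
      (φ : (T.gen → MvPolynomial V K) →ₗ[MvPolynomial V K] (S.gen → MvPolynomial V K)),
      IsGradedMap T.deg S.deg φ ∧ LinearMap.range φ = S.N ∧ LinearMap.ker φ = T.N := by
  have := S.fin
  obtain ⟨k, e, φ, h1, h2, h3⟩ := exists_minimal_cover S.deg S.N S.graded
  exact ⟨⟨Fin k, inferInstance, e, LinearMap.ker φ, h1.ker, h3⟩, φ, h1, h2, rfl⟩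

attribute [local instance] MvPolynomial.gradedAlgebra in
/-- The quotient by a homogeneous ideal has a minimal graded free resolution. -/
theorem exists_resolution [Finite V] (I : Ideal (MvPolynomial V K))
    (hI : I.IsHomogeneous (homogeneousSubmodule V K)) :
    Nonempty (MinimalGradedFreeResolution I) := by
  classical
  let G : Type := {_u : Unit // I ≠ ⊤}
  let aug : (G → MvPolynomial V K) →ₗ[MvPolynomial V K] (MvPolynomial V K ⧸ I) :=
    (Submodule.mkQ I).comp (Fintype.linearCombination (MvPolynomial V K) fun _ : G => 1)
  have haug : ∀ x, aug x = Ideal.Quotient.mk I (∑ a, x a) := by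
    intro x
    simp [aug, Fintype.linearCombination_apply]
  have hsum : ∀ (x : G → MvPolynomial V K) (a : G), ∑ b, x b = x a := by
    intro x a
    rw [Finset.sum_eq_single a]
    · intro b _ hb; exact absurd (Subsingleton.elim b a) hb
    · intro h; exact absurd (Finset.mem_univ a) h
  have hmem : ∀ x, x ∈ LinearMap.ker aug ↔ ∀ a, x a ∈ I := by
    intro x
    rw [LinearMap.mem_ker, haug, Ideal.Quotient.eq_zero_iff_mem]
    constructor
    · intro h a; rwa [hsum x a] at h
    · intro h; exact I.sum_mem fun a _ => h a
  let S₀ : Stage V K :=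
    { gen := G
      fin := inferInstance
      deg := fun _ => 0
      N := LinearMap.ker aug
      graded := by
        intro x hx n
        rw [hmem] at hx ⊢
        intro a
        simpa [comp] using homogeneousComponent_mem_of_mem hI (hx a) n
      small := by
        intro x hx a
        rw [hmem] at hx
        rw [mem_idealOfVars_iff]
        by_contra hne
        apply a.2
        have h0 := homogeneousComponent_mem_of_mem hI (hx a) 0
        rw [homogeneousComponent_zero] at h0
        exact Ideal.eq_top_of_isUnit_mem I h0 ((isUnit_iff_ne_zero.mpr hne).map C) }
  let next : Stage V K → Stage V K := fun S => S.exists_next.choose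
  let S : ℕ → Stage V K := fun n => Nat.rec S₀ (fun _ T => next T) n
  have hS : ∀ n, ∃ φ : ((S (n + 1)).gen → MvPolynomial V K) →ₗ[MvPolynomial V K]
      ((S n).gen → MvPolynomial V K), IsGradedMap (S (n + 1)).deg (S n).deg φ ∧
        LinearMap.range φ = (S n).N ∧ LinearMap.ker φ = (S (n + 1)).N :=
    fun n => (S n).exists_next.choose_spec
  choose φ h1 h2 h3 using hS
  refine ⟨⟨fun n => (S n).gen, fun n => (S n).fin, fun n => (S n).deg, φ, aug, h1, ?_, ?_, ?_, ?_,
    ?_⟩⟩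
  · intro n x hx
    change G → MvPolynomial V K at x
    refine ⟨∑ a : G, x a, ?_, haug x⟩
    refine IsHomogeneous.sum _ _ _ fun a _ => ?_
    rcases hx a with h | ⟨m, hm, h⟩
    · rw [h]; exact isHomogeneous_zero _ _ _
    · obtain rfl : m = n := hm
      exact h
  · intro y
    obtain ⟨f, rfl⟩ := Ideal.Quotient.mk_surjective y
    by_cases hI' : I = ⊤
    · refine ⟨0, ?_⟩
      rw [map_zero, eq_comm, Ideal.Quotient.eq_zero_iff_mem, hI']
      trivial
    · refine ⟨fun _ => f, ?_⟩
      rw [haug, hsum _ ⟨(), hI'⟩]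
  · exact LinearMap.exact_iff.mpr (h2 0).symm
  · intro i
    exact LinearMap.exact_iff.mpr ((h3 i).trans (h2 (i + 1)).symm)
  · intro i x j
    exact (S i).small _ ((h2 i) ▸ LinearMap.mem_range_self (φ i) x) j

attribute [local instance] MvPolynomial.gradedAlgebra in
theorem stanleyReisnerIdeal_isHomogeneous (Δ : PreAbstractSimplicialComplex V) :
    (stanleyReisnerIdeal K Δ).IsHomogeneous (homogeneousSubmodule V K) := by
  refine Ideal.homogeneous_span _ _ ?_
  rintro _ ⟨s, _, rfl⟩
  refine ⟨s.card, ?_⟩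
  rw [mem_homogeneousSubmodule]
  simpa using IsHomogeneous.prod s (fun v => (X v : MvPolynomial V K)) (fun _ => 1)
    fun v _ => isHomogeneous_X K v

end Resolutions

/-- The Betti number `β_{i,d}` over the field `K` of a simplicial complex `Δ` with finite vertex set
`V`: the rank of `R(-d)` in the `i`-th module of a minimal graded free resolution of the
Stanley-Reisner ring `K[Δ]` over `R = K[V]`. -/
noncomputable def bettiNumber {V : Type u} [Finite V] (K : Type w) [Field K]
    (Δ : PreAbstractSimplicialComplex V) (i d : ℕ) : ℕ :=
  (exists_resolution (stanleyReisnerIdeal K Δ) (stanleyReisnerIdeal_isHomogeneous Δ)).some.betti i d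

end BettiJoin

/-! The Stanley-Reisner ideal of the join is generated by the extensions of the two given ideals
(`stanleyReisnerIdeal_join`), so that `K[Δ₁ * Δ₂] = K[Δ₁] ⊗ K[Δ₂]` over `K`. If `F` and `G` are
minimal graded free resolutions of the factors, the total complex of `F ⊗ G` over `K` is a complex
of graded free modules over `K[V₁ ⊕ V₂]`. It resolves the tensor product, since `K` is a field, and
its differential has entries in `𝔪`, since those of `F` and `G` do. A generator of it in degrees
`(i, d)` is a pair of generators in degrees `(p, r)` and `(q, s)` with `p + q = i` and `r + s = d`;
counting these pairs gives the formula (`exists_tensor_resolution`, `card_tensorGen`).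

Two facts support this. Betti numbers are defined by a chosen resolution, so their independence of
the choice is needed (`betti_eq`): comparison maps between two minimal resolutions compose to the
identity modulo `𝔪`, and their constant terms give matrices `B * A = 1` in each degree. Exactness of
the total complex replaces the Künneth theorem by explicit formulas: exact sequences of vector
spaces have contracting homotopies (`exists_contraction`), and those of `F` and `G` combine to a
preimage of each cycle (`exists_total_preimage`). The contractions are linear only over `K`, hence
the parallel use of `outerMap` and `outerLinearMap`. -/

namespace BettiJoin

open MvPolynomial

universe u v w

/-! ### Lifting graded maps out of graded free modules -/

section Lifting

variable {V : Type u} {K : Type w} [Field K]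

theorem isHomogeneousVec_single {ι : Type} [DecidableEq ι] (deg : ι → ℕ) (j : ι) :
    IsHomogeneousVec deg (deg j) (Pi.single j (1 : MvPolynomial V K)) := by
  intro k
  by_cases h : k = j
  · subst h
    right
    exact ⟨0, by omega, by simpa using isHomogeneous_one V K⟩
  · left
    simp [h]

theorem isGradedMap_linearCombination {ι κ : Type} [Fintype ι] {deg : ι → ℕ} {deg' : κ → ℕ}
    {g : ι → κ → MvPolynomial V K} (hg : ∀ a, IsHomogeneousVec deg' (deg a) (g a)) :
    IsGradedMap deg deg' (Fintype.linearCombination (MvPolynomial V K) g) := by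
  intro n x hx
  rw [Fintype.linearCombination_apply]
  refine IsHomogeneousVec.sum _ fun a _ => ?_
  rcases hx a with h | ⟨m, hm, h⟩
  · rw [h, zero_smul]; exact IsHomogeneousVec.zero deg' n
  · rw [← hm]; exact (hg a).smul h

theorem isGradedMap_of_single {ι κ : Type} [Finite ι] [DecidableEq ι] {deg : ι → ℕ} {deg' : κ → ℕ}
    {φ : (ι → MvPolynomial V K) →ₗ[MvPolynomial V K] (κ → MvPolynomial V K)}
    (h : ∀ a, IsHomogeneousVec deg' (deg a) (φ (Pi.single a 1))) : IsGradedMap deg deg' φ := by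
  cases nonempty_fintype ι
  have : φ = Fintype.linearCombination (MvPolynomial V K) fun a => φ (Pi.single a 1) :=
    LinearMap.pi_ext' fun a => LinearMap.ext_ring (by simp)
  rw [this]
  exact isGradedMap_linearCombination h

/-- A linear map from a finite free module lifts along a linear map whose range contains its
range. -/
theorem exists_lift {R : Type*} [CommRing R] {ι : Type*} [Finite ι] {M N : Type*}
    [AddCommGroup M] [AddCommGroup N] [Module R M] [Module R N] (ψ : M →ₗ[R] N)
    (φ : (ι → R) →ₗ[R] N) (h : ∀ x, φ x ∈ LinearMap.range ψ) :
    ∃ f : (ι → R) →ₗ[R] M, ψ ∘ₗ f = φ := by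
  classical
  cases nonempty_fintype ι
  choose b hb using fun j => h (Pi.single j 1)
  refine ⟨Fintype.linearCombination R b, LinearMap.pi_ext' fun j => LinearMap.ext_ring ?_⟩
  simp [hb]

/-- A graded map from a finite graded free module lifts to a graded map. -/
theorem exists_graded_lift {ι β κ : Type} [Finite ι] [Finite β] {deg : ι → ℕ} {deg' : β → ℕ}
    {deg'' : κ → ℕ} {ψ : (β → MvPolynomial V K) →ₗ[MvPolynomial V K] (κ → MvPolynomial V K)}
    {φ : (ι → MvPolynomial V K) →ₗ[MvPolynomial V K] (κ → MvPolynomial V K)}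
    (hψ : IsGradedMap deg' deg'' ψ) (hφ : IsGradedMap deg deg'' φ)
    (h : ∀ x, φ x ∈ LinearMap.range ψ) :
    ∃ f : (ι → MvPolynomial V K) →ₗ[MvPolynomial V K] (β → MvPolynomial V K),
      IsGradedMap deg deg' f ∧ ψ ∘ₗ f = φ := by
  classical
  cases nonempty_fintype ι
  choose b hb using fun j => h (Pi.single j 1)
  -- The preimage `b j` need not be homogeneous. Its component of degree `deg j` still maps to `φ
  -- (Pi.single j 1)`, because `ψ` commutes with taking components.
  refine ⟨Fintype.linearCombination _ fun j => comp deg' (deg j) (b j),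
    isGradedMap_linearCombination fun j => comp_homogeneous _ _ _,
    LinearMap.pi_ext' fun j => LinearMap.ext_ring ?_⟩
  have := comp_of_homogeneous (hφ _ _ (isHomogeneousVec_single deg j)) (deg j)
  simp [hψ.comp_apply, hb, this]

/-- A linear map of free modules preserves the submodule of vectors with coordinates in an ideal. -/
theorem apply_mem_of_coord_mem {R : Type*} [CommRing R] {ι κ : Type*} [Finite ι] (I : Ideal R)
    (f : (ι → R) →ₗ[R] (κ → R)) {x : ι → R} (hx : ∀ j, x j ∈ I) (k : κ) : f x k ∈ I := by
  classical
  cases nonempty_fintype ι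
  rw [LinearMap.pi_apply_eq_sum_univ f x, Finset.sum_apply]
  exact I.sum_mem fun j _ => I.mul_mem_right _ (hx j)

end Lifting

/-! ### Independence of the Betti numbers from the minimal resolution -/

section Uniqueness

variable {V : Type u} {K : Type w} [Field K] {I : Ideal (MvPolynomial V K)}

namespace MinimalGradedFreeResolution

theorem diff_diff (F : MinimalGradedFreeResolution I) (n : ℕ) (x) :
    F.diff n (F.diff (n + 1) x) = 0 :=
  (F.exact_diff n).apply_apply_eq_zero x

attribute [local instance] MvPolynomial.gradedAlgebra in
/-- The class of a homogeneous polynomial has a homogeneous preimage under the augmentation. -/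
theorem exists_homogeneous_aug_eq (hI : I.IsHomogeneous (homogeneousSubmodule V K))
    (G : MinimalGradedFreeResolution I) {n : ℕ} {p : MvPolynomial V K} (hp : p.IsHomogeneous n) :
    ∃ y, IsHomogeneousVec (G.deg 0) n y ∧ G.aug y = Ideal.Quotient.mk I p := by
  classical
  have := G.finite_gen 0
  obtain ⟨y, hy⟩ := G.aug_surjective (Ideal.Quotient.mk I p)
  refine ⟨comp (G.deg 0) n y, comp_homogeneous _ _ _, ?_⟩
  choose f hf hfa using fun m => G.aug_graded m _ (comp_homogeneous (G.deg 0) m y)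
  obtain ⟨N, hN⟩ := sum_comp (G.deg 0) y
  -- The range is enlarged so that it contains the index `n`; the added components of `y` are zero.
  have hN' : ∑ m ∈ Finset.range (max N (n + 1)), comp (G.deg 0) m y = y := by
    conv_rhs => rw [← hN]
    symm
    refine Finset.sum_subset (Finset.range_subset_range.mpr (le_max_left _ _)) fun m _ hm => ?_
    rw [← hN, comp_sum]
    refine Finset.sum_eq_zero fun k hk => ?_
    rw [comp_of_homogeneous (comp_homogeneous _ _ _), if_neg]
    rintro rfl
    exact hm hk
  have hmem : p - ∑ m ∈ Finset.range (max N (n + 1)), f m ∈ I := by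
    rw [← Ideal.Quotient.eq_zero_iff_mem, map_sub, map_sum, ← hy]
    conv_lhs => enter [1]; rw [← hN', map_sum]
    simp [hfa]
  -- Since `I` is homogeneous, the degree `n` part `p - f n` of the difference lies in `I` as well.
  have h1 := homogeneousComponent_mem_of_mem hI hmem n
  rw [map_sub, map_sum, homogeneousComponent_of_mem ((mem_homogeneousSubmodule _ _).mpr hp),
    if_pos rfl, Finset.sum_eq_single n] at h1
  · rw [homogeneousComponent_of_mem ((mem_homogeneousSubmodule _ _).mpr (hf n)), if_pos rfl] at h1
    rw [hfa]
    exact (Ideal.Quotient.eq.mpr h1).symm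
  · intro m _ hm
    rw [homogeneousComponent_of_mem ((mem_homogeneousSubmodule _ _).mpr (hf m)), if_neg hm.symm]
  · intro h
    exact absurd (Finset.mem_range.mpr (by omega)) h

attribute [local instance] MvPolynomial.gradedAlgebra in
-- The start of the comparison. The target of the augmentation is a quotient ring and not a free
-- module, so `exists_graded_lift` does not apply and homogeneous preimages come from
-- `exists_homogeneous_aug_eq`.
theorem exists_graded_aug_lift (hI : I.IsHomogeneous (homogeneousSubmodule V K))
    (F G : MinimalGradedFreeResolution I) :
    ∃ f : (F.gen 0 → MvPolynomial V K) →ₗ[MvPolynomial V K] (G.gen 0 → MvPolynomial V K),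
      IsGradedMap (F.deg 0) (G.deg 0) f ∧ G.aug ∘ₗ f = F.aug := by
  classical
  have := F.finite_gen 0
  cases nonempty_fintype (F.gen 0)
  choose p hp hpa using fun j => F.aug_graded _ _ (isHomogeneousVec_single (F.deg 0) j)
  choose y hy hya using fun j => G.exists_homogeneous_aug_eq hI (hp j)
  refine ⟨Fintype.linearCombination _ y, isGradedMap_linearCombination hy,
    LinearMap.pi_ext' fun j => LinearMap.ext_ring ?_⟩
  simp [hya, hpa]

attribute [local instance] MvPolynomial.gradedAlgebra in
/-- Comparison of two minimal resolutions: in each homological degree there are graded maps in both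
directions whose composition is the identity modulo `𝔪`. -/
theorem exists_comparison (hI : I.IsHomogeneous (homogeneousSubmodule V K))
    (F G : MinimalGradedFreeResolution I) (n : ℕ) :
    ∃ (f : (F.gen n → MvPolynomial V K) →ₗ[MvPolynomial V K] (G.gen n → MvPolynomial V K))
      (g : (G.gen n → MvPolynomial V K) →ₗ[MvPolynomial V K] (F.gen n → MvPolynomial V K))
      (h : (F.gen n → MvPolynomial V K) →ₗ[MvPolynomial V K] (F.gen (n + 1) → MvPolynomial V K)),
      IsGradedMap (F.deg n) (G.deg n) f ∧ IsGradedMap (G.deg n) (F.deg n) g ∧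
      (∀ x, f (F.diff n x) ∈ LinearMap.range (G.diff n)) ∧
      (∀ x, g (G.diff n x) ∈ LinearMap.range (F.diff n)) ∧
      (∀ x, g (f (F.diff n x)) - F.diff n x = F.diff n (h (F.diff n x))) ∧
      ∀ x j, (g (f x) - x) j ∈ idealOfVars V K := by
  -- The homotopy relation `g f - 1 = ∂ h + h' ∂`, with `h'` from one degree below, is recorded only
  -- on boundaries, where the term with `h'` drops out. The next degree needs no more than this.
  induction n with
  | zero =>
    have := F.finite_gen 0
    obtain ⟨f, hf, hfa⟩ := exists_graded_aug_lift hI F G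
    obtain ⟨g, hg, hga⟩ := exists_graded_aug_lift hI G F
    have hfa' : ∀ x, G.aug (f x) = F.aug x := fun x => LinearMap.congr_fun hfa x
    have hga' : ∀ x, F.aug (g x) = G.aug x := fun x => LinearMap.congr_fun hga x
    have key : ∀ x, (g ∘ₗ f - LinearMap.id :
        (F.gen 0 → MvPolynomial V K) →ₗ[MvPolynomial V K] _) x ∈ LinearMap.range (F.diff 0) := by
      intro x
      refine (F.exact_aug _).mp ?_
      simp [hga', hfa']
    obtain ⟨h, hh⟩ := exists_lift (F.diff 0) _ key
    have hh' : ∀ x, g (f x) - x = F.diff 0 (h x) := fun x => (LinearMap.congr_fun hh x).symm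
    refine ⟨f, g, h, hf, hg, fun x => (G.exact_aug _).mp ?_, fun x => (F.exact_aug _).mp ?_,
      fun x => hh' _, fun x j => ?_⟩
    · rw [hfa', F.exact_aug.apply_apply_eq_zero]
    · rw [hga', G.exact_aug.apply_apply_eq_zero]
    · rw [hh']
      exact F.minimal _ _ _
  | succ n ih =>
    obtain ⟨f, g, h, hf, hg, hfr, hgr, hh, -⟩ := ih
    have := F.finite_gen n
    have := G.finite_gen n
    have := F.finite_gen (n + 1)
    have := G.finite_gen (n + 1)
    obtain ⟨f', hf', hfd⟩ := exists_graded_lift (φ := f ∘ₗ F.diff n) (deg := F.deg (n + 1))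
      (G.diff_graded n) (fun m x hx => hf _ _ (F.diff_graded n _ _ hx)) hfr
    obtain ⟨g', hg', hgd⟩ := exists_graded_lift (φ := g ∘ₗ G.diff n) (deg := G.deg (n + 1))
      (F.diff_graded n) (fun m x hx => hg _ _ (G.diff_graded n _ _ hx)) hgr
    have hfd' : ∀ x, G.diff n (f' x) = f (F.diff n x) := fun x => LinearMap.congr_fun hfd x
    have hgd' : ∀ x, F.diff n (g' x) = g (G.diff n x) := fun x => LinearMap.congr_fun hgd x
    -- `∂` sends this map to `g f ∂ - ∂ - ∂ h ∂`, which is zero by `hh`, so exactness puts its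
    -- values among the boundaries and the next homotopy is a lift of it.
    have key : ∀ x, (g' ∘ₗ f' - LinearMap.id - h ∘ₗ F.diff n :
        (F.gen (n + 1) → MvPolynomial V K) →ₗ[MvPolynomial V K] _) x ∈
          LinearMap.range (F.diff (n + 1)) := by
      intro x
      refine (F.exact_diff n _).mp ?_
      simp [hgd', hfd', ← hh]
    obtain ⟨h', hh'⟩ := exists_lift (F.diff (n + 1)) _ key
    have hh'' : ∀ x, g' (f' x) - x = F.diff (n + 1) (h' x) + h (F.diff n x) := fun x => by
      have := LinearMap.congr_fun hh' x
      simp only [LinearMap.comp_apply, LinearMap.sub_apply, LinearMap.id_apply] at this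
      rw [this]; abel
    refine ⟨f', g', h', hf', hg', fun x => (G.exact_diff n _).mp ?_,
      fun x => (F.exact_diff n _).mp ?_, fun x => ?_, fun x j => ?_⟩
    · rw [hfd', F.diff_diff, map_zero]
    · rw [hgd', G.diff_diff, map_zero]
    · rw [hh'', F.diff_diff, map_zero, add_zero]
    · rw [hh'']
      -- Minimality is used for both terms: `∂ h'` has entries in `𝔪`, and `h ∂` does because `h` is
      -- linear over the polynomial ring.
      exact Ideal.add_mem _ (F.minimal _ _ _) (apply_mem_of_coord_mem _ h (F.minimal _ _) _)

end MinimalGradedFreeResolution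

/-- Graded maps of graded free modules in both directions whose composition is the identity modulo
`𝔪` give an inequality between the numbers of generators of each degree. -/
theorem card_deg_le {ι κ : Type} [Finite ι] [Finite κ] {deg : ι → ℕ} {deg' : κ → ℕ}
    {f : (ι → MvPolynomial V K) →ₗ[MvPolynomial V K] (κ → MvPolynomial V K)}
    {g : (κ → MvPolynomial V K) →ₗ[MvPolynomial V K] (ι → MvPolynomial V K)}
    (hf : IsGradedMap deg deg' f)
    (hgf : ∀ x j, (g (f x) - x) j ∈ idealOfVars V K) (d : ℕ) :
    Nat.card {j : ι // deg j = d} ≤ Nat.card {k : κ // deg' k = d} := by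
  classical
  cases nonempty_fintype ι
  cases nonempty_fintype κ
  -- `A` and `B` are the blocks in degree `d` of `f` and `g` reduced modulo `𝔪`.
  let A : Matrix {k : κ // deg' k = d} {j : ι // deg j = d} K :=
    fun k j => constantCoeff (f (Pi.single j.1 1) k.1)
  let B : Matrix {j : ι // deg j = d} {k : κ // deg' k = d} K :=
    fun j k => constantCoeff (g (Pi.single k.1 1) j.1)
  have hBA : B * A = 1 := by
    ext j j'
    have h1 := (mem_idealOfVars_iff _).mp (hgf (Pi.single j'.1 1) j.1)
    rw [LinearMap.pi_apply_eq_sum_univ g (f _)] at h1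
    simp only [Pi.sub_apply, Finset.sum_apply, Pi.smul_apply, smul_eq_mul, map_sub, map_sum,
      map_mul, sub_eq_zero] at h1
    have h2 : (1 : Matrix {j : ι // deg j = d} {j : ι // deg j = d} K) j j' =
        constantCoeff ((Pi.single j'.1 1 : ι → MvPolynomial V K) j.1) := by
      simp only [Matrix.one_apply, Pi.single_apply, Subtype.ext_iff]
      split_ifs <;> simp
    rw [h2, ← h1, Matrix.mul_apply]
    -- Such a coordinate is zero or homogeneous of positive degree. Generators of other degrees
    -- therefore contribute nothing to the product, and the degree `d` blocks alone multiply to the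
    -- identity.
    have h3 : ∀ k, deg' k ≠ d → constantCoeff (f (Pi.single j'.1 1) k) = 0 := by
      intro k hk
      rcases hf _ _ (isHomogeneousVec_single deg j'.1) k with h | ⟨m, hm, h⟩
      · rw [h, map_zero]
      · rw [constantCoeff_eq]
        refine h.coeff_eq_zero ?_
        have := j'.2
        simp
        omega
    rw [← Finset.sum_subset (Finset.filter_subset (fun k => deg' k = d) Finset.univ),
      Finset.sum_subtype _ (p := fun k => deg' k = d) (by simp)]
    · refine Finset.sum_congr rfl fun k _ => (mul_comm _ _).trans ?_
      have : (fun l => if k.1 = l then 1 else 0 : κ → MvPolynomial V K) = Pi.single k.1 1 := by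
        ext1 l
        simp [Pi.single_apply, eq_comm]
      rw [this]
    · intro k _ hk
      rw [h3 k (by simpa using hk), zero_mul]
  -- The identity matrix has rank the number of columns of `A`, and the rank of `A` is at most its
  -- number of rows.
  have h1 := Matrix.rank_mul_le_right B A
  rw [hBA, Matrix.rank_one] at h1
  rw [Nat.card_eq_fintype_card, Nat.card_eq_fintype_card]
  exact h1.trans (Matrix.rank_le_card_height A)

attribute [local instance] MvPolynomial.gradedAlgebra in
/-- The graded Betti numbers do not depend on the minimal resolution. -/
theorem MinimalGradedFreeResolution.betti_eq (hI : I.IsHomogeneous (homogeneousSubmodule V K))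
    (F G : MinimalGradedFreeResolution I) (i d : ℕ) : F.betti i d = G.betti i d := by
  have := F.finite_gen i
  have := G.finite_gen i
  apply le_antisymm
  · obtain ⟨f, g, h, hf, -, -, -, -, hgf⟩ := exists_comparison hI F G i
    exact card_deg_le hf hgf d
  · obtain ⟨f, g, h, hf, -, -, -, -, hgf⟩ := exists_comparison hI G F i
    exact card_deg_le hf hgf d

/-- Frees `bettiNumber` from the resolution chosen in its definition, so that the join can be
computed with the tensor product resolution. -/
theorem bettiNumber_eq_betti [Finite V] (Δ : PreAbstractSimplicialComplex V)
    (F : MinimalGradedFreeResolution (stanleyReisnerIdeal K Δ)) (i d : ℕ) :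
    bettiNumber K Δ i d = F.betti i d :=
  MinimalGradedFreeResolution.betti_eq (stanleyReisnerIdeal_isHomogeneous Δ) _ _ _ _

end Uniqueness

/-! ### Contracting homotopies over a field and exactness of total complexes -/

section Contraction

/-- Over a field, the surjection of `M` onto the range of `φ` has a linear section, and the section
extends from the range to `N`. -/
theorem exists_generalized_inverse {K M N : Type*} [Field K] [AddCommGroup M] [AddCommGroup N]
    [Module K M] [Module K N] (φ : M →ₗ[K] N) : ∃ t : N →ₗ[K] M, ∀ x, φ (t (φ x)) = φ x := by
  obtain ⟨g, hg⟩ := φ.rangeRestrict.exists_rightInverse_of_surjective φ.range_rangeRestrict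
  obtain ⟨t, ht⟩ := g.exists_extend
  refine ⟨t, fun x => ?_⟩
  have h1 : t (φ x) = g (φ.rangeRestrict x) := by
    rw [← ht]; rfl
  rw [h1]
  exact congrArg Subtype.val (LinearMap.congr_fun hg (φ.rangeRestrict x))

/-- An exact sequence of vector spaces is contractible. -/
theorem exists_contraction {K : Type*} [Field K] {M : ℕ → Type*} {Q : Type*}
    [∀ n, AddCommGroup (M n)] [∀ n, Module K (M n)] [AddCommGroup Q] [Module K Q]
    (d : ∀ n, M (n + 1) →ₗ[K] M n) (ε : M 0 →ₗ[K] Q) (h₀ : Function.Exact (d 0) ε)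
    (h : ∀ n, Function.Exact (d (n + 1)) (d n)) :
    ∃ (s : ∀ n, M n →ₗ[K] M (n + 1)) (σ : Q →ₗ[K] M 0),
      (∀ n x, d (n + 1) (s (n + 1) x) + s n (d n x) = x) ∧
      (∀ x, d 0 (s 0 x) + σ (ε x) = x) ∧ ∀ x, σ (ε (d 0 x)) = 0 := by
  choose t ht using fun n => exists_generalized_inverse (d n)
  obtain ⟨σ, hσ⟩ := exists_generalized_inverse ε
  -- `1 - t n ∘ d n` has values in the kernel of `d n`, that is, in the range of `d (n + 1)`, where
  -- `d (n + 1) ∘ t (n + 1)` is the identity. In degree zero `σ ∘ ε` plays the role of `t n ∘ d n`.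
  -- The correction vanishes on boundaries, so `s n ∘ d n = t n ∘ d n`.
  let s : ∀ n, M n →ₗ[K] M (n + 1) := fun n =>
    Nat.casesOn n (t 0 ∘ₗ (LinearMap.id - σ ∘ₗ ε))
      fun n => t (n + 1) ∘ₗ (LinearMap.id - t n ∘ₗ d n)
  have hs0 : ∀ x, s 0 x = t 0 (x - σ (ε x)) := fun x => rfl
  have hs : ∀ n x, s (n + 1) x = t (n + 1) (x - t n (d n x)) := fun n x => rfl
  have hsd : ∀ n x, s n (d n x) = t n (d n x) := by
    rintro (_ | n) x
    · rw [hs0, h₀.apply_apply_eq_zero, map_zero, sub_zero]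
    · rw [hs, (h n).apply_apply_eq_zero, map_zero, sub_zero]
  refine ⟨s, σ, fun n x => ?_, fun x => ?_, fun x => ?_⟩
  · rw [hsd, hs]
    obtain ⟨y, hy⟩ := (h n (x - t n (d n x))).mp (by rw [map_sub, ht, sub_self])
    rw [← hy, ht, hy, sub_add_cancel]
  · rw [hs0]
    obtain ⟨y, hy⟩ := (h₀ (x - σ (ε x))).mp (by rw [map_sub, hσ, sub_self])
    rw [← hy, ht, hy, sub_add_cancel]
  · rw [h₀.apply_apply_eq_zero, map_zero]

/-- The total complex of a double complex whose rows and columns have compatible contractions is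
exact: the cycle `x` is the boundary of an explicit element, which is supported in total degree
`n + 1` if `x` is supported in total degree `n`. -/
theorem exists_total_preimage {C : ℕ → ℕ → Type*} [∀ p q, AddCommGroup (C p q)]
    (a : ∀ p q, C (p + 1) q →+ C p q) (b : ∀ p q, C p (q + 1) →+ C p q)
    (s : ∀ p q, C p q →+ C (p + 1) q) (t : ∀ p q, C p q →+ C p (q + 1))
    (π : ∀ q, C 0 q →+ C 0 q) (π' : ∀ p, C p 0 →+ C p 0)
    (has : ∀ p q x, a (p + 1) q (s (p + 1) q x) + s p q (a p q x) = x)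
    (has₀ : ∀ q x, a 0 q (s 0 q x) + π q x = x)
    (hbt : ∀ p q x, b p (q + 1) (t p (q + 1) x) + t p q (b p q x) = x)
    (hbt₀ : ∀ p x, b p 0 (t p 0 x) + π' p x = x)
    (hπa : ∀ q x, π q (a 0 q x) = 0)
    (hbs : ∀ p q x, b (p + 1) q (s p (q + 1) x) = s p q (b p q x))
    (hta : ∀ p q x, t p q (a p q x) = a p (q + 1) (t (p + 1) q x))
    (hbπ : ∀ q x, b 0 q (π (q + 1) x) = π q (b 0 q x))
    {n : ℕ} (x : ∀ p q, C p q) (hxn : ∀ p q, p + q ≠ n → x p q = 0)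
    (hx : ∀ p q, a p q (x (p + 1) q) + (-1 : ℤ) ^ p • b p q (x p (q + 1)) = 0)
    (hx₀ : π 0 (π' 0 (x 0 0)) = 0) :
    ∃ y : ∀ p q, C p q, (∀ p q, p + q ≠ n + 1 → y p q = 0) ∧
      ∀ p q, a p q (y (p + 1) q) + (-1 : ℤ) ^ p • b p q (y p (q + 1)) = x p q := by
  -- The homotopy is `s + π t`: `s` contracts everything up to the projection `π` onto a part of the
  -- column `p = 0`, and `t` contracts that part.
  let y : ∀ p q, C p q := fun p q => match p, q with
    | p + 1, q => s p q (x p q)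
    | 0, q + 1 => π (q + 1) (t 0 q (x 0 q))
    | 0, 0 => 0
  have hy : ∀ p q, y (p + 1) q = s p q (x p q) := fun p q => rfl
  have hy₀ : ∀ q, y 0 (q + 1) = π (q + 1) (t 0 q (x 0 q)) := fun q => rfl
  refine ⟨y, ?_, ?_⟩
  · rintro (_ | p) (_ | q) h
    · rfl
    · rw [hy₀, hxn 0 q (by omega), map_zero, map_zero]
    · rw [hy, hxn p 0 (by omega), map_zero]
    · rw [hy, hxn p (q + 1) (by omega), map_zero]
  · rintro (_ | p) q
    · have h1 := has₀ q (x 0 q)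
      rw [hy, hy₀, hbπ, pow_zero, one_smul]
      conv_rhs => rw [← h1]
      congr 1
      -- It remains that `π b t x = π x` in the column `p = 0`. For `q = 0` the difference is `π π'
      -- x = 0`. For larger `q` it is `π t b x`, which by the cycle condition equals `-π t a x = -π
      -- a t x = 0`.
      rcases q with _ | q
      · have h2 := congrArg (π 0) (hbt₀ 0 (x 0 0))
        rwa [map_add, hx₀, add_zero] at h2
      · have h2 := congrArg (π (q + 1)) (hbt 0 q (x 0 (q + 1)))
        have h3 := congrArg (fun z => π (q + 1) (t 0 q z)) (hx 0 q)
        simp only [pow_zero, one_smul, map_add, hta, hπa, map_zero, zero_add] at h3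
        rwa [map_add, h3, add_zero] at h2
    -- The cycle condition turns `(-1) ^ (p + 1) • s b x` into `s a x`, and `a s + s a = 1`
    -- finishes.
    · have h1 := has p q (x (p + 1) q)
      have h2 := congrArg (s p q) (hx p q)
      rw [map_zero, map_add, map_zsmul] at h2
      rw [hy, hy, hbs, pow_succ, mul_neg_one, neg_smul]
      rw [eq_neg_of_add_eq_zero_right h2, neg_neg, h1]

end Contraction

/-! ### Tensor products over `K` of free modules over `K[V₁]` and `K[V₂]` -/

section Outer

variable {V₁ : Type u} {V₂ : Type v} {K : Type w} [Field K]

open TensorProduct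

theorem tensorEquivSum_tmul (f : MvPolynomial V₁ K) (g : MvPolynomial V₂ K) :
    tensorEquivSum K V₁ V₂ K (f ⊗ₜ g) = rename Sum.inl f * rename Sum.inr g := by
  have h1 : (tensorEquivSum K V₁ V₂ K).toAlgHom.comp Algebra.TensorProduct.includeLeft =
      rename Sum.inl := by
    ext v; simp
  have h2 : (tensorEquivSum K V₁ V₂ K).toAlgHom.comp Algebra.TensorProduct.includeRight =
      rename Sum.inr := by
    ext v; simp
  rw [← h1, ← h2]
  simp [← map_mul]

/-- The tensor product of a vector over `K[V₁]` and a vector over `K[V₂]`, as a vector over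
`K[V₁ ⊕ V₂]`. -/
noncomputable def outer {ι κ : Type} (x : ι → MvPolynomial V₁ K) (y : κ → MvPolynomial V₂ K) :
    ι × κ → MvPolynomial (V₁ ⊕ V₂) K :=
  fun c => rename Sum.inl (x c.1) * rename Sum.inr (y c.2)

theorem smul_outer {ι κ : Type} (f : MvPolynomial V₁ K) (g : MvPolynomial V₂ K)
    (x : ι → MvPolynomial V₁ K) (y : κ → MvPolynomial V₂ K) :
    (rename Sum.inl f * rename Sum.inr g : MvPolynomial (V₁ ⊕ V₂) K) • outer x y =
      outer (f • x) (g • y) := by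
  ext1 c
  simp only [outer, Pi.smul_apply, smul_eq_mul, map_mul]
  ring

theorem outer_single {ι κ : Type} [DecidableEq ι] [DecidableEq κ] [DecidableEq (ι × κ)]
    (a : ι) (b : κ) :
    outer (Pi.single a (1 : MvPolynomial V₁ K)) (Pi.single b (1 : MvPolynomial V₂ K)) =
      Pi.single (a, b) 1 := by
  ext1 ⟨a', b'⟩
  by_cases h : a' = a <;> by_cases h' : b' = b <;> simp [outer, h, h']

theorem IsHomogeneousVec.outer {ι κ : Type} {deg : ι → ℕ} {deg' : κ → ℕ} {m n : ℕ}
    {x : ι → MvPolynomial V₁ K} {y : κ → MvPolynomial V₂ K} (hx : IsHomogeneousVec deg m x)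
    (hy : IsHomogeneousVec deg' n y) :
    IsHomogeneousVec (fun c : ι × κ => deg c.1 + deg' c.2) (m + n) (outer x y) := by
  intro c
  rcases hx c.1 with h | ⟨k, hk, h⟩
  · left; simp [BettiJoin.outer, h]
  rcases hy c.2 with h' | ⟨k', hk', h'⟩
  · left; simp [BettiJoin.outer, h']
  · right
    exact ⟨k + k', by grind, h.rename_isHomogeneous.mul h'.rename_isHomogeneous⟩

/-- The tensor product of two finite free modules over `K[V₁]` and `K[V₂]` is a free module over
`K[V₁ ⊕ V₂]`. -/
noncomputable def outerEquiv (K : Type w) [Field K] (V₁ : Type u) (V₂ : Type v) (ι κ : Type)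
    [Finite ι] [Finite κ] :
    ((ι → MvPolynomial V₁ K) ⊗[K] (κ → MvPolynomial V₂ K)) ≃ₗ[K]
      (ι × κ → MvPolynomial (V₁ ⊕ V₂) K) := by
  classical
  exact
  letI := Fintype.ofFinite ι
  letI := Fintype.ofFinite κ
  (TensorProduct.piLeft K (κ → MvPolynomial V₂ K) fun _ : ι => MvPolynomial V₁ K) ≪≫ₗ
    LinearEquiv.piCongrRight (fun _ =>
      (TensorProduct.piRight K K (MvPolynomial V₁ K) fun _ : κ => MvPolynomial V₂ K) ≪≫ₗ
        LinearEquiv.piCongrRight fun _ => (tensorEquivSum K V₁ V₂ K).toLinearEquiv) ≪≫ₗ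
    (LinearEquiv.curry K _ ι κ).symm

theorem outerEquiv_tmul {ι κ : Type} [Finite ι] [Finite κ] (x : ι → MvPolynomial V₁ K)
    (y : κ → MvPolynomial V₂ K) : outerEquiv K V₁ V₂ ι κ (x ⊗ₜ y) = outer x y := by
  ext1 ⟨a, b⟩
  simp [outerEquiv, outer, tensorEquivSum_tmul]

/-- Pure tensors span, and `outerEquiv` is onto; additive identities need only be checked on vectors
`outer x y`. -/
theorem outer_induction {ι κ : Type} [Finite ι] [Finite κ]
    {P : (ι × κ → MvPolynomial (V₁ ⊕ V₂) K) → Prop} (h₀ : P 0) (h : ∀ x y, P (outer x y))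
    (hadd : ∀ z z', P z → P z' → P (z + z')) (z) : P z := by
  obtain ⟨t, rfl⟩ := (outerEquiv K V₁ V₂ ι κ).surjective z
  induction t using TensorProduct.induction_on with
  | zero => rwa [map_zero]
  | tmul x y => rw [outerEquiv_tmul]; exact h x y
  | add t t' ht ht' => rw [map_add]; exact hadd _ _ ht ht'

theorem mvPolynomial_sum_induction {P : MvPolynomial (V₁ ⊕ V₂) K → Prop} (h₀ : P 0)
    (h : ∀ f g, P (rename Sum.inl f * rename Sum.inr g))
    (hadd : ∀ p p', P p → P p' → P (p + p')) (p) : P p := by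
  obtain ⟨t, rfl⟩ := (tensorEquivSum K V₁ V₂ K).surjective p
  induction t using TensorProduct.induction_on with
  | zero => rwa [map_zero]
  | tmul x y => rw [tensorEquivSum_tmul]; exact h x y
  | add t t' ht ht' => rw [map_add]; exact hadd _ _ ht ht'

/-- The tensor product of two linear maps over `K`, as a map of vectors over `K[V₁ ⊕ V₂]`. -/
noncomputable def outerMap {ι ι' κ κ' : Type} [Finite ι] [Finite ι'] [Finite κ] [Finite κ']
    (φ : (ι → MvPolynomial V₁ K) →ₗ[K] (ι' → MvPolynomial V₁ K))
    (ψ : (κ → MvPolynomial V₂ K) →ₗ[K] (κ' → MvPolynomial V₂ K)) :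
    (ι × κ → MvPolynomial (V₁ ⊕ V₂) K) →ₗ[K] (ι' × κ' → MvPolynomial (V₁ ⊕ V₂) K) :=
  (outerEquiv K V₁ V₂ ι' κ').toLinearMap ∘ₗ TensorProduct.map φ ψ ∘ₗ
    (outerEquiv K V₁ V₂ ι κ).symm.toLinearMap

theorem outerMap_outer {ι ι' κ κ' : Type} [Finite ι] [Finite ι'] [Finite κ] [Finite κ']
    (φ : (ι → MvPolynomial V₁ K) →ₗ[K] (ι' → MvPolynomial V₁ K))
    (ψ : (κ → MvPolynomial V₂ K) →ₗ[K] (κ' → MvPolynomial V₂ K)) (x y) :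
    outerMap φ ψ (outer x y) = outer (φ x) (ψ y) := by
  rw [← outerEquiv_tmul, ← outerEquiv_tmul]
  simp [outerMap]

/-- This and the next lemmas carry the identities of the contractions of `F` and `G` over to the
rows and columns of the double complex. They are stated over `K`, the only scalars over which the
contractions are linear. -/
theorem outerMap_comp {ι ι' ι'' κ κ' κ'' : Type} [Finite ι] [Finite ι'] [Finite κ] [Finite κ']
    [Finite ι''] [Finite κ'']
    (φ : (ι → MvPolynomial V₁ K) →ₗ[K] (ι' → MvPolynomial V₁ K))
    (ψ : (κ → MvPolynomial V₂ K) →ₗ[K] (κ' → MvPolynomial V₂ K))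
    (φ' : (ι' → MvPolynomial V₁ K) →ₗ[K] (ι'' → MvPolynomial V₁ K))
    (ψ' : (κ' → MvPolynomial V₂ K) →ₗ[K] (κ'' → MvPolynomial V₂ K)) (z) :
    outerMap φ' ψ' (outerMap φ ψ z) = outerMap (φ' ∘ₗ φ) (ψ' ∘ₗ ψ) z := by
  simp [outerMap, TensorProduct.map_map]

theorem outerMap_id (K : Type w) [Field K] (V₁ : Type u) (V₂ : Type v) (ι κ : Type) [Finite ι]
    [Finite κ] (z : ι × κ → MvPolynomial (V₁ ⊕ V₂) K) :
    outerMap LinearMap.id LinearMap.id z = z := by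
  simp [outerMap]

theorem outerMap_add_left {ι ι' κ κ' : Type} [Finite ι] [Finite ι'] [Finite κ] [Finite κ']
    (φ φ' : (ι → MvPolynomial V₁ K) →ₗ[K] (ι' → MvPolynomial V₁ K))
    (ψ : (κ → MvPolynomial V₂ K) →ₗ[K] (κ' → MvPolynomial V₂ K)) (z) :
    outerMap φ ψ z + outerMap φ' ψ z = outerMap (φ + φ') ψ z := by
  simp [outerMap, TensorProduct.map_add_left]

theorem outerMap_add_right {ι ι' κ κ' : Type} [Finite ι] [Finite ι'] [Finite κ] [Finite κ']
    (φ : (ι → MvPolynomial V₁ K) →ₗ[K] (ι' → MvPolynomial V₁ K))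
    (ψ ψ' : (κ → MvPolynomial V₂ K) →ₗ[K] (κ' → MvPolynomial V₂ K)) (z) :
    outerMap φ ψ z + outerMap φ ψ' z = outerMap φ (ψ + ψ') z := by
  simp [outerMap, TensorProduct.map_add_right]

theorem outerMap_zero_left {ι ι' κ κ' : Type} [Finite ι] [Finite ι'] [Finite κ] [Finite κ']
    (ψ : (κ → MvPolynomial V₂ K) →ₗ[K] (κ' → MvPolynomial V₂ K))
    (z : ι × κ → MvPolynomial (V₁ ⊕ V₂) K) :
    (outerMap 0 ψ z : ι' × κ' → MvPolynomial (V₁ ⊕ V₂) K) = 0 := by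
  simp [outerMap]

/-- The tensor product of two linear maps over `K[V₁]` and `K[V₂]` is linear over
`K[V₁ ⊕ V₂]`. -/
noncomputable def outerLinearMap {ι ι' κ κ' : Type} [Finite ι] [Finite ι'] [Finite κ] [Finite κ']
    (φ : (ι → MvPolynomial V₁ K) →ₗ[MvPolynomial V₁ K] (ι' → MvPolynomial V₁ K))
    (ψ : (κ → MvPolynomial V₂ K) →ₗ[MvPolynomial V₂ K] (κ' → MvPolynomial V₂ K)) :
    (ι × κ → MvPolynomial (V₁ ⊕ V₂) K) →ₗ[MvPolynomial (V₁ ⊕ V₂) K]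
      (ι' × κ' → MvPolynomial (V₁ ⊕ V₂) K) where
  toFun := outerMap (φ.restrictScalars K) (ψ.restrictScalars K)
  map_add' := map_add _
  map_smul' r z := by
    -- Scalar and vector are both reduced to pure products, where `smul_outer` separates the
    -- variables.
    induction r using mvPolynomial_sum_induction with
    | h₀ => simp
    | hadd p p' h h' => rw [add_smul, map_add, h, h', RingHom.id_apply, RingHom.id_apply,
        RingHom.id_apply, add_smul]
    | h f g =>
      induction z using outer_induction with
      | h₀ => simp
      | hadd z z' h h' => rw [smul_add, map_add, h, h', map_add, smul_add]
      | h x y =>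
        rw [smul_outer, outerMap_outer, outerMap_outer, RingHom.id_apply, smul_outer]
        simp

theorem outerLinearMap_apply {ι ι' κ κ' : Type} [Finite ι] [Finite ι'] [Finite κ] [Finite κ']
    (φ : (ι → MvPolynomial V₁ K) →ₗ[MvPolynomial V₁ K] (ι' → MvPolynomial V₁ K))
    (ψ : (κ → MvPolynomial V₂ K) →ₗ[MvPolynomial V₂ K] (κ' → MvPolynomial V₂ K)) (z) :
    outerLinearMap φ ψ z = outerMap (φ.restrictScalars K) (ψ.restrictScalars K) z := rfl

theorem outerLinearMap_outer {ι ι' κ κ' : Type} [Finite ι] [Finite ι'] [Finite κ] [Finite κ']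
    (φ : (ι → MvPolynomial V₁ K) →ₗ[MvPolynomial V₁ K] (ι' → MvPolynomial V₁ K))
    (ψ : (κ → MvPolynomial V₂ K) →ₗ[MvPolynomial V₂ K] (κ' → MvPolynomial V₂ K)) (x y) :
    outerLinearMap φ ψ (outer x y) = outer (φ x) (ψ y) :=
  outerMap_outer _ _ _ _

theorem outerLinearMap_isGradedMap {ι ι' κ κ' : Type} [Finite ι] [Finite ι'] [Finite κ]
    [Finite κ'] {d₁ : ι → ℕ} {d₁' : ι' → ℕ} {d₂ : κ → ℕ} {d₂' : κ' → ℕ}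
    {φ : (ι → MvPolynomial V₁ K) →ₗ[MvPolynomial V₁ K] (ι' → MvPolynomial V₁ K)}
    {ψ : (κ → MvPolynomial V₂ K) →ₗ[MvPolynomial V₂ K] (κ' → MvPolynomial V₂ K)}
    (hφ : IsGradedMap d₁ d₁' φ) (hψ : IsGradedMap d₂ d₂' ψ) :
    IsGradedMap (fun c : ι × κ => d₁ c.1 + d₂ c.2) (fun c : ι' × κ' => d₁' c.1 + d₂' c.2)
      (outerLinearMap φ ψ) := by
  classical
  refine isGradedMap_of_single ?_
  rintro ⟨a, b⟩
  rw [← outer_single a b, outerLinearMap_outer]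
  exact (hφ _ _ (isHomogeneousVec_single d₁ a)).outer (hψ _ _ (isHomogeneousVec_single d₂ b))

theorem outerLinearMap_apply_mem_left {ι ι' κ κ' : Type} [Finite ι] [Finite ι'] [Finite κ]
    [Finite κ']
    {φ : (ι → MvPolynomial V₁ K) →ₗ[MvPolynomial V₁ K] (ι' → MvPolynomial V₁ K)}
    (hφ : ∀ x j, φ x j ∈ idealOfVars V₁ K)
    (ψ : (κ → MvPolynomial V₂ K) →ₗ[MvPolynomial V₂ K] (κ' → MvPolynomial V₂ K)) (z c) :
    outerLinearMap φ ψ z c ∈ idealOfVars (V₁ ⊕ V₂) K := by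
  induction z using outer_induction with
  | h₀ => simp
  | hadd z z' h h' => rw [map_add]; exact Ideal.add_mem _ h h'
  | h x y =>
    have := (mem_idealOfVars_iff _).mp (hφ x c.1)
    rw [outerLinearMap_outer, mem_idealOfVars_iff]
    simp [outer, constantCoeff_rename, this]

theorem outerLinearMap_apply_mem_right {ι ι' κ κ' : Type} [Finite ι] [Finite ι'] [Finite κ]
    [Finite κ']
    (φ : (ι → MvPolynomial V₁ K) →ₗ[MvPolynomial V₁ K] (ι' → MvPolynomial V₁ K))
    {ψ : (κ → MvPolynomial V₂ K) →ₗ[MvPolynomial V₂ K] (κ' → MvPolynomial V₂ K)}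
    (hψ : ∀ x j, ψ x j ∈ idealOfVars V₂ K) (z c) :
    outerLinearMap φ ψ z c ∈ idealOfVars (V₁ ⊕ V₂) K := by
  induction z using outer_induction with
  | h₀ => simp
  | hadd z z' h h' => rw [map_add]; exact Ideal.add_mem _ h h'
  | h x y =>
    have := (mem_idealOfVars_iff _).mp (hψ y c.2)
    rw [outerLinearMap_outer, mem_idealOfVars_iff]
    simp [outer, constantCoeff_rename, this]

theorem outerLinearMap_comp {ι ι' ι'' κ κ' κ'' : Type} [Finite ι] [Finite ι'] [Finite κ]
    [Finite κ'] [Finite ι''] [Finite κ'']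
    (φ : (ι → MvPolynomial V₁ K) →ₗ[MvPolynomial V₁ K] (ι' → MvPolynomial V₁ K))
    (ψ : (κ → MvPolynomial V₂ K) →ₗ[MvPolynomial V₂ K] (κ' → MvPolynomial V₂ K))
    (φ' : (ι' → MvPolynomial V₁ K) →ₗ[MvPolynomial V₁ K] (ι'' → MvPolynomial V₁ K))
    (ψ' : (κ' → MvPolynomial V₂ K) →ₗ[MvPolynomial V₂ K] (κ'' → MvPolynomial V₂ K)) (z) :
    outerLinearMap φ' ψ' (outerLinearMap φ ψ z) = outerLinearMap (φ' ∘ₗ φ) (ψ' ∘ₗ ψ) z := by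
  rw [outerLinearMap_apply, outerLinearMap_apply, outerLinearMap_apply, outerMap_comp,
    LinearMap.restrictScalars_comp, LinearMap.restrictScalars_comp]

theorem outerLinearMap_eq_zero {ι ι' κ κ' : Type} [Finite ι] [Finite ι'] [Finite κ] [Finite κ']
    {φ : (ι → MvPolynomial V₁ K) →ₗ[MvPolynomial V₁ K] (ι' → MvPolynomial V₁ K)}
    {ψ : (κ → MvPolynomial V₂ K) →ₗ[MvPolynomial V₂ K] (κ' → MvPolynomial V₂ K)}
    (h : φ = 0 ∨ ψ = 0) (z) : outerLinearMap φ ψ z = 0 := by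
  rw [outerLinearMap_apply, outerMap]
  rcases h with rfl | rfl <;> simp

end Outer

/-! ### The total complex of two resolutions and its exactness -/

section TensorResolution

variable {V₁ : Type u} {V₂ : Type v} {K : Type w} [Field K]
  {I₁ : Ideal (MvPolynomial V₁ K)} {I₂ : Ideal (MvPolynomial V₂ K)}

open TensorProduct

/-- The ideal of `K[V₁ ⊕ V₂]` generated by an ideal of `K[V₁]` and an ideal of `K[V₂]`. -/
noncomputable def sumIdeal (I₁ : Ideal (MvPolynomial V₁ K)) (I₂ : Ideal (MvPolynomial V₂ K)) :
    Ideal (MvPolynomial (V₁ ⊕ V₂) K) :=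
  I₁.map (rename Sum.inl : MvPolynomial V₁ K →ₐ[K] _) ⊔
    I₂.map (rename Sum.inr : MvPolynomial V₂ K →ₐ[K] _)

/-- The map from `K[V₁ ⊕ V₂] ⧸ (I₁ + I₂)` to the tensor product of `K[V₁] ⧸ I₁` and
`K[V₂] ⧸ I₂`. -/
noncomputable def quotientToTensor (I₁ : Ideal (MvPolynomial V₁ K))
    (I₂ : Ideal (MvPolynomial V₂ K)) :
    (MvPolynomial (V₁ ⊕ V₂) K ⧸ sumIdeal I₁ I₂) →ₐ[K]
      ((MvPolynomial V₁ K ⧸ I₁) ⊗[K] (MvPolynomial V₂ K ⧸ I₂)) :=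
  Ideal.Quotient.liftₐ _ ((Algebra.TensorProduct.map (Ideal.Quotient.mkₐ K I₁)
    (Ideal.Quotient.mkₐ K I₂)).comp (tensorEquivSum K V₁ V₂ K).symm.toAlgHom) (by
      intro a ha
      have h1 : sumIdeal I₁ I₂ ≤ RingHom.ker ((Algebra.TensorProduct.map (Ideal.Quotient.mkₐ K I₁)
          (Ideal.Quotient.mkₐ K I₂)).comp (tensorEquivSum K V₁ V₂ K).symm.toAlgHom) := by
        refine sup_le (Ideal.map_le_iff_le_comap.mpr fun f hf => ?_)
          (Ideal.map_le_iff_le_comap.mpr fun f hf => ?_)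
        · have h2 : (tensorEquivSum K V₁ V₂ K).symm (rename Sum.inl f) = f ⊗ₜ 1 := by
            rw [AlgEquiv.symm_apply_eq, tensorEquivSum_tmul, map_one, mul_one]
          rw [Ideal.mem_comap, RingHom.mem_ker]
          simp [h2, Ideal.Quotient.eq_zero_iff_mem.mpr hf]
        · have h2 : (tensorEquivSum K V₁ V₂ K).symm (rename Sum.inr f) = 1 ⊗ₜ f := by
            rw [AlgEquiv.symm_apply_eq, tensorEquivSum_tmul, map_one, one_mul]
          rw [Ideal.mem_comap, RingHom.mem_ker]
          simp [h2, Ideal.Quotient.eq_zero_iff_mem.mpr hf]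
      exact h1 ha)

theorem quotientToTensor_mk (f : MvPolynomial V₁ K) (g : MvPolynomial V₂ K) :
    quotientToTensor I₁ I₂ (Ideal.Quotient.mk _ (rename Sum.inl f * rename Sum.inr g)) =
      Ideal.Quotient.mk I₁ f ⊗ₜ Ideal.Quotient.mk I₂ g := by
  have h2 : (tensorEquivSum K V₁ V₂ K).symm (rename Sum.inl f * rename Sum.inr g) = f ⊗ₜ g := by
    rw [AlgEquiv.symm_apply_eq, tensorEquivSum_tmul]
  have h3 : quotientToTensor I₁ I₂ (Ideal.Quotient.mk _ (rename Sum.inl f * rename Sum.inr g)) =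
      (Algebra.TensorProduct.map (Ideal.Quotient.mkₐ K I₁)
        (Ideal.Quotient.mkₐ K I₂)) ((tensorEquivSum K V₁ V₂ K).symm
          (rename Sum.inl f * rename Sum.inr g)) := rfl
  rw [h3, h2]
  rfl

namespace MinimalGradedFreeResolution

variable (F : MinimalGradedFreeResolution I₁) (G : MinimalGradedFreeResolution I₂)

/-- Homogeneous representatives of the images of the generators under the augmentation. -/
theorem exists_aug_representatives {V : Type u} {I : Ideal (MvPolynomial V K)}
    (F : MinimalGradedFreeResolution I) :
    ∃ m : F.gen 0 → MvPolynomial V K, (∀ j, (m j).IsHomogeneous (F.deg 0 j)) ∧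
      ∀ [Fintype (F.gen 0)] x, F.aug x = Ideal.Quotient.mk I (∑ j, x j * m j) := by
  classical
  choose m hm hma using fun j => F.aug_graded _ _ (isHomogeneousVec_single (F.deg 0) j)
  refine ⟨m, hm, fun x => ?_⟩
  have : F.aug = Submodule.mkQ I ∘ₗ Fintype.linearCombination (MvPolynomial V K) m := by
    refine LinearMap.pi_ext' fun j => LinearMap.ext_ring ?_
    simp [hma]
  rw [this]
  simp [Fintype.linearCombination_apply]

/-- The augmentation of the tensor product of two resolutions. -/
theorem exists_tensor_aug :
    ∃ ε : (F.gen 0 × G.gen 0 → MvPolynomial (V₁ ⊕ V₂) K) →ₗ[MvPolynomial (V₁ ⊕ V₂) K]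
        (MvPolynomial (V₁ ⊕ V₂) K ⧸ sumIdeal I₁ I₂),
      (∀ n x, IsHomogeneousVec (fun c : F.gen 0 × G.gen 0 => F.deg 0 c.1 + G.deg 0 c.2) n x →
        ∃ f : MvPolynomial (V₁ ⊕ V₂) K, f.IsHomogeneous n ∧ ε x = Ideal.Quotient.mk _ f) ∧
      (∀ x y f g, F.aug x = Ideal.Quotient.mk I₁ f → G.aug y = Ideal.Quotient.mk I₂ g →
        ε (outer x y) = Ideal.Quotient.mk _ (rename Sum.inl f * rename Sum.inr g)) := by
  classical
  have := F.finite_gen 0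
  have := G.finite_gen 0
  cases nonempty_fintype (F.gen 0)
  cases nonempty_fintype (G.gen 0)
  obtain ⟨m, hm, hma⟩ := F.exists_aug_representatives
  obtain ⟨m', hm', hma'⟩ := G.exists_aug_representatives
  let ε : (F.gen 0 × G.gen 0 → MvPolynomial (V₁ ⊕ V₂) K) →ₗ[MvPolynomial (V₁ ⊕ V₂) K]
        (MvPolynomial (V₁ ⊕ V₂) K ⧸ sumIdeal I₁ I₂) :=
    -- On generators, `ε` is the class of the product of homogeneous representatives of the two
    -- augmentations. This makes it linear over `K[V₁ ⊕ V₂]` and graded at once.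
    Submodule.mkQ _ ∘ₗ Fintype.linearCombination (MvPolynomial (V₁ ⊕ V₂) K)
      fun c : F.gen 0 × G.gen 0 => rename Sum.inl (m c.1) * rename Sum.inr (m' c.2)
  have hε : ∀ z, ε z = Ideal.Quotient.mk _
      (∑ c, z c * (rename Sum.inl (m c.1) * rename Sum.inr (m' c.2))) := fun z => by
    simp [ε, Fintype.linearCombination_apply]
  refine ⟨ε, fun n x hx => ⟨_, ?_, hε x⟩, fun x y f g hf hg => ?_⟩
  · refine IsHomogeneous.sum _ _ _ fun c _ => ?_
    rcases hx c with h | ⟨k, hk, h⟩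
    · rw [h, zero_mul]; exact isHomogeneous_zero _ _ _
    · rw [← hk]
      exact h.mul ((hm c.1).rename_isHomogeneous.mul (hm' c.2).rename_isHomogeneous)
  · have h1 : ∑ c, outer x y c * (rename Sum.inl (m c.1) * rename Sum.inr (m' c.2)) =
        (rename Sum.inl (∑ j, x j * m j) * rename Sum.inr (∑ j, y j * m' j) :
          MvPolynomial (V₁ ⊕ V₂) K) := by
      rw [map_sum, map_sum, Finset.sum_mul_sum, Fintype.sum_prod_type]
      refine Finset.sum_congr rfl fun a _ => Finset.sum_congr rfl fun b _ => ?_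
      simp only [outer, map_mul]
      ring
    have h2 : Ideal.Quotient.mk (sumIdeal I₁ I₂) (rename Sum.inl (∑ j, x j * m j)) =
        Ideal.Quotient.mk _ (rename Sum.inl f) := by
      rw [Ideal.Quotient.eq, ← map_sub]
      exact Ideal.mem_sup_left (Ideal.mem_map_of_mem _ (Ideal.Quotient.eq.mp (hma x ▸ hf)))
    have h3 : Ideal.Quotient.mk (sumIdeal I₁ I₂) (rename Sum.inr (∑ j, y j * m' j)) =
        Ideal.Quotient.mk _ (rename Sum.inr g) := by
      rw [Ideal.Quotient.eq, ← map_sub]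
      exact Ideal.mem_sup_right (Ideal.mem_map_of_mem _ (Ideal.Quotient.eq.mp (hma' y ▸ hg)))
    rw [hε, h1, map_mul, map_mul, h2, h3]

/-- The generators of the tensor product in homological degree `n`. -/
def TensorGen (n : ℕ) : Type :=
  {z : Σ p q, F.gen p × G.gen q // z.1 + z.2.1 = n}

/-- The modules of the double complex given by two resolutions. -/
abbrev Bimodule (p q : ℕ) : Type _ := F.gen p × G.gen q → MvPolynomial (V₁ ⊕ V₂) K

/-- Extension by zero from total degree `n` to the product of all the modules of the double
complex. -/
noncomputable def tensorExtend (n : ℕ) :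
    (TensorGen F G n → MvPolynomial (V₁ ⊕ V₂) K) →ₗ[MvPolynomial (V₁ ⊕ V₂) K]
      (∀ p q, Bimodule F G p q) where
  toFun x p q c := if h : p + q = n then x ⟨⟨p, q, c⟩, h⟩ else 0
  map_add' x y := by
    ext1 p; ext1 q; ext1 c
    by_cases h : p + q = n
    · simp only [dif_pos h, Pi.add_apply]; rfl
    · simp [h]
  map_smul' r x := by
    ext1 p; ext1 q; ext1 c
    by_cases h : p + q = n
    · simp only [dif_pos h, Pi.smul_apply]; rfl
    · simp [h]

/-- Restriction to total degree `n`. -/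
noncomputable def tensorRestrict (n : ℕ) :
    (∀ p q, Bimodule F G p q) →ₗ[MvPolynomial (V₁ ⊕ V₂) K]
      (TensorGen F G n → MvPolynomial (V₁ ⊕ V₂) K) where
  toFun x z := x z.1.1 z.1.2.1 z.1.2.2
  map_add' _ _ := rfl
  map_smul' _ _ := rfl

/-- The differential of the total complex of the double complex. -/
noncomputable def totalDiff :
    (∀ p q, Bimodule F G p q) →ₗ[MvPolynomial (V₁ ⊕ V₂) K] (∀ p q, Bimodule F G p q) :=
  haveI := F.finite_gen
  haveI := G.finite_gen
  LinearMap.pi fun p => LinearMap.pi fun q =>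
    outerLinearMap (F.diff p) LinearMap.id ∘ₗ LinearMap.proj q ∘ₗ LinearMap.proj (p + 1) +
      (-1 : ℤ) ^ p • (outerLinearMap LinearMap.id (G.diff q) ∘ₗ LinearMap.proj (q + 1) ∘ₗ
        LinearMap.proj p)

theorem totalDiff_apply [∀ n, Finite (F.gen n)] [∀ n, Finite (G.gen n)]
    (x : ∀ p q, Bimodule F G p q) (p q : ℕ) :
    totalDiff F G x p q = outerLinearMap (F.diff p) LinearMap.id (x (p + 1) q) +
      (-1 : ℤ) ^ p • outerLinearMap LinearMap.id (G.diff q) (x p (q + 1)) := by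
  simp only [totalDiff, LinearMap.pi_apply, LinearMap.add_apply, LinearMap.smul_apply,
    LinearMap.comp_apply, LinearMap.proj_apply]

/-- The form of the differential that can be composed with the `K`-linear contractions. -/
theorem totalDiff_apply_eq_outerMap [∀ n, Finite (F.gen n)] [∀ n, Finite (G.gen n)]
    (x : ∀ p q, Bimodule F G p q) (p q : ℕ) :
    totalDiff F G x p q = outerMap ((F.diff p).restrictScalars K) LinearMap.id (x (p + 1) q) +
      (-1 : ℤ) ^ p • outerMap LinearMap.id ((G.diff q).restrictScalars K) (x p (q + 1)) := by
  rw [totalDiff_apply, outerLinearMap_apply, outerLinearMap_apply, LinearMap.restrictScalars_id,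
    LinearMap.restrictScalars_id]

theorem tensorRestrict_extend (n : ℕ) (x) : tensorRestrict F G n (tensorExtend F G n x) = x := by
  funext ⟨z, hz⟩
  simp [tensorRestrict, tensorExtend, hz]

theorem tensorExtend_apply_of_ne {n p q : ℕ} (h : p + q ≠ n) (x) :
    tensorExtend F G n x p q = 0 := by
  funext c
  simp [tensorExtend, h]

/-- Calculations take place in the product over all `p` and `q`, which avoids transport along
equations `p + q = n`. A family supported in total degree `n` loses nothing on restriction to that
degree. -/
theorem tensorExtend_restrict {n : ℕ} {x : ∀ p q, Bimodule F G p q}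
    (hx : ∀ p q, p + q ≠ n → x p q = 0) : tensorExtend F G n (tensorRestrict F G n x) = x := by
  funext p q c
  by_cases h : p + q = n
  · simp [tensorRestrict, tensorExtend, h]
  · rw [tensorExtend_apply_of_ne F G h, hx p q h]

theorem totalDiff_apply_of_ne {n : ℕ} {x : ∀ p q, Bimodule F G p q}
    (hx : ∀ p q, p + q ≠ n + 1 → x p q = 0) (p q : ℕ) (h : p + q ≠ n) :
    totalDiff F G x p q = 0 := by
  have := F.finite_gen
  have := G.finite_gen
  rw [totalDiff_apply, hx (p + 1) q (by omega), hx p (q + 1) (by omega)]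
  simp

/-- The pure terms contain the square of a differential. The two mixed terms are equal up to the
signs `(-1) ^ (p + 1)` and `(-1) ^ p`, and cancel. -/
theorem totalDiff_totalDiff (x) : totalDiff F G (totalDiff F G x) = 0 := by
  have := F.finite_gen
  have := G.finite_gen
  funext p q
  have h1 : F.diff p ∘ₗ F.diff (p + 1) = 0 := LinearMap.ext (F.diff_diff p)
  have h2 : G.diff q ∘ₗ G.diff (q + 1) = 0 := LinearMap.ext (G.diff_diff q)
  rw [totalDiff_apply, totalDiff_apply, totalDiff_apply]
  simp only [map_add, map_zsmul, outerLinearMap_comp, LinearMap.comp_id, LinearMap.id_comp,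
    outerLinearMap_eq_zero (Or.inl h1), outerLinearMap_eq_zero (Or.inr h2), pow_succ]
  simp

/-- A cycle of positive total degree is a boundary, and so is a chain of total degree zero that is
sent to zero by the augmentation. -/
theorem exists_totalDiff_eq {n : ℕ} {x : ∀ p q, Bimodule F G p q}
    (hxn : ∀ p q, p + q ≠ n → x p q = 0) (hx : totalDiff F G x = 0)
    {ε : (F.gen 0 × G.gen 0 → MvPolynomial (V₁ ⊕ V₂) K) →ₗ[MvPolynomial (V₁ ⊕ V₂) K]
        (MvPolynomial (V₁ ⊕ V₂) K ⧸ sumIdeal I₁ I₂)}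
    (hε : ∀ x y f g, F.aug x = Ideal.Quotient.mk I₁ f → G.aug y = Ideal.Quotient.mk I₂ g →
        ε (outer x y) = Ideal.Quotient.mk _ (rename Sum.inl f * rename Sum.inr g))
    (hx₀ : ε (x 0 0) = 0) :
    ∃ y, (∀ p q, p + q ≠ n + 1 → y p q = 0) ∧ totalDiff F G y = x := by
  have := F.finite_gen
  have := G.finite_gen
  let dF : ∀ n, (F.gen (n + 1) → MvPolynomial V₁ K) →ₗ[K] (F.gen n → MvPolynomial V₁ K) :=
    fun n => (F.diff n).restrictScalars K
  let dG : ∀ n, (G.gen (n + 1) → MvPolynomial V₂ K) →ₗ[K] (G.gen n → MvPolynomial V₂ K) :=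
    fun n => (G.diff n).restrictScalars K
  obtain ⟨s, σ, hs, hs₀, hσ⟩ := exists_contraction (M := fun n => F.gen n → MvPolynomial V₁ K)
    dF (F.aug.restrictScalars K) F.exact_aug F.exact_diff
  obtain ⟨t, τ, ht, ht₀, -⟩ := exists_contraction (M := fun n => G.gen n → MvPolynomial V₂ K)
    dG (G.aug.restrictScalars K) G.exact_aug G.exact_diff
  let π := σ ∘ₗ F.aug.restrictScalars K
  let π' := τ ∘ₗ G.aug.restrictScalars K
  have e1 : ∀ n, dF (n + 1) ∘ₗ s (n + 1) + s n ∘ₗ dF n = LinearMap.id :=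
    fun n => LinearMap.ext (hs n)
  have e2 : dF 0 ∘ₗ s 0 + π = LinearMap.id := LinearMap.ext hs₀
  have e3 : π ∘ₗ dF 0 = 0 := LinearMap.ext hσ
  have e4 : ∀ n, dG (n + 1) ∘ₗ t (n + 1) + t n ∘ₗ dG n = LinearMap.id :=
    fun n => LinearMap.ext (ht n)
  have e5 : dG 0 ∘ₗ t 0 + π' = LinearMap.id := LinearMap.ext ht₀
  -- The composition of `π` and `π'` factors through `ε`, so `ε (x 0 0) = 0` yields the last
  -- hypothesis of `exists_total_preimage`. For this, a map from the quotient to the tensor product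
  -- suffices; it need not be known to be an isomorphism.
  have hker : ∀ z, ((outerEquiv K V₁ V₂ _ _).toLinearMap ∘ₗ TensorProduct.map σ τ ∘ₗ
      (quotientToTensor I₁ I₂).toLinearMap ∘ₗ ε.restrictScalars K) z =
        outerMap π LinearMap.id (outerMap LinearMap.id π' z) := by
    intro z
    induction z using outer_induction with
    | h₀ => simp
    | hadd z z' h h' => rw [map_add, map_add, map_add, h, h']
    | h x y =>
      obtain ⟨f, hf⟩ := Ideal.Quotient.mk_surjective (F.aug x)
      obtain ⟨g, hg⟩ := Ideal.Quotient.mk_surjective (G.aug y)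
      rw [outerMap_outer, outerMap_outer]
      simp only [LinearMap.comp_apply, LinearMap.restrictScalars_apply, AlgHom.toLinearMap_apply,
        hε x y f g hf.symm hg.symm, quotientToTensor_mk, hf, hg, TensorProduct.map_tmul,
        LinearEquiv.coe_coe, outerEquiv_tmul, π, π', LinearMap.id_apply]
  obtain ⟨y, hy, hy'⟩ := exists_total_preimage (C := fun p q => Bimodule F G p q)
    (fun p q => (outerMap (dF p) (LinearMap.id (M := G.gen q → _))).toAddMonoidHom)
    (fun p q => (outerMap (LinearMap.id (M := F.gen p → _)) (dG q)).toAddMonoidHom)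
    (fun p q => (outerMap (s p) (LinearMap.id (M := G.gen q → _))).toAddMonoidHom)
    (fun p q => (outerMap (LinearMap.id (M := F.gen p → _)) (t q)).toAddMonoidHom)
    (fun q => (outerMap π (LinearMap.id (M := G.gen q → _))).toAddMonoidHom)
    (fun p => (outerMap (LinearMap.id (M := F.gen p → _)) π').toAddMonoidHom)
    (fun p q x => by
      simp only [LinearMap.toAddMonoidHom_coe, outerMap_comp, outerMap_add_left,
        LinearMap.comp_id, e1, outerMap_id])
    (fun q x => by
      simp only [LinearMap.toAddMonoidHom_coe, outerMap_comp, outerMap_add_left,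
        LinearMap.comp_id, e2, outerMap_id])
    (fun p q x => by
      simp only [LinearMap.toAddMonoidHom_coe, outerMap_comp, outerMap_add_right,
        LinearMap.comp_id, e4, outerMap_id])
    (fun p x => by
      simp only [LinearMap.toAddMonoidHom_coe, outerMap_comp, outerMap_add_right,
        LinearMap.comp_id, e5, outerMap_id])
    (fun q x => by
      simp only [LinearMap.toAddMonoidHom_coe, outerMap_comp, e3, outerMap_zero_left])
    (fun p q x => by
      simp only [LinearMap.toAddMonoidHom_coe, outerMap_comp, LinearMap.comp_id,
        LinearMap.id_comp])
    (fun p q x => by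
      simp only [LinearMap.toAddMonoidHom_coe, outerMap_comp, LinearMap.comp_id,
        LinearMap.id_comp])
    (fun q x => by
      simp only [LinearMap.toAddMonoidHom_coe, outerMap_comp, LinearMap.comp_id,
        LinearMap.id_comp])
    x hxn (fun p q => (totalDiff_apply_eq_outerMap F G x p q).symm.trans (congrFun (congrFun hx p) q))
    (by
      simp only [LinearMap.toAddMonoidHom_coe]
      rw [← hker]
      simp only [LinearMap.comp_apply, LinearMap.restrictScalars_apply, hx₀, map_zero])
  exact ⟨y, hy, funext fun p => funext fun q =>
    (totalDiff_apply_eq_outerMap F G y p q).trans (hy' p q)⟩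

end MinimalGradedFreeResolution

end TensorResolution

/-! ### The tensor product resolution and the count of its generators -/

section TensorResolution

variable {V₁ : Type u} {V₂ : Type v} {K : Type w} [Field K]
  {I₁ : Ideal (MvPolynomial V₁ K)} {I₂ : Ideal (MvPolynomial V₂ K)}

theorem IsHomogeneousVec.neg {V : Type u} {ι : Type} {deg : ι → ℕ} {n : ℕ}
    {x : ι → MvPolynomial V K} (hx : IsHomogeneousVec deg n x) : IsHomogeneousVec deg n (-x) := by
  intro j
  rcases hx j with h | ⟨m, hm, h⟩
  · left; simp [h]
  · right; exact ⟨m, hm, h.neg⟩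

namespace MinimalGradedFreeResolution

variable (F : MinimalGradedFreeResolution I₁) (G : MinimalGradedFreeResolution I₂)

theorem finite_tensorGen (n : ℕ) : Finite (TensorGen F G n) := by
  have := F.finite_gen
  have := G.finite_gen
  refine Finite.of_injective (β := Σ (p : Fin (n + 1)) (q : Fin (n + 1)), F.gen p × G.gen q)
    (fun z => ⟨⟨z.1.1, by have := z.2; omega⟩, ⟨z.1.2.1, by have := z.2; omega⟩, z.1.2.2⟩) ?_
  rintro ⟨⟨p, q, c⟩, h⟩ ⟨⟨p', q', c'⟩, h'⟩ heq
  simp only [Sigma.mk.injEq, Fin.mk.injEq] at heq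
  obtain ⟨rfl, heq⟩ := heq
  simp only [heq_eq_eq, Sigma.mk.injEq, Fin.mk.injEq] at heq
  obtain ⟨rfl, heq⟩ := heq
  simp only [heq_eq_eq] at heq
  subst heq
  rfl

/-- The degrees of the generators of the tensor product. -/
def tensorDeg (n : ℕ) (z : TensorGen F G n) : ℕ :=
  F.deg _ z.1.2.2.1 + G.deg _ z.1.2.2.2

theorem tensorExtend_homogeneous {n m : ℕ} {x : TensorGen F G n → MvPolynomial (V₁ ⊕ V₂) K}
    (hx : IsHomogeneousVec (tensorDeg F G n) m x) (p q : ℕ) :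
    IsHomogeneousVec (fun c => F.deg p c.1 + G.deg q c.2) m (tensorExtend F G n x p q) := by
  by_cases h : p + q = n
  · intro c
    have h1 : tensorExtend F G n x p q c = x ⟨⟨p, q, c⟩, h⟩ := by simp [tensorExtend, h]
    rw [h1]
    exact hx ⟨⟨p, q, c⟩, h⟩
  · rw [tensorExtend_apply_of_ne F G h]
    exact IsHomogeneousVec.zero _ _

theorem tensorRestrict_homogeneous {n m : ℕ} {x : ∀ p q, Bimodule F G p q}
    (hx : ∀ p q, IsHomogeneousVec (fun c => F.deg p c.1 + G.deg q c.2) m (x p q)) :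
    IsHomogeneousVec (tensorDeg F G n) m (tensorRestrict F G n x) :=
  fun z => hx _ _ z.1.2.2

theorem totalDiff_homogeneous {m : ℕ} {x : ∀ p q, Bimodule F G p q}
    (hx : ∀ p q, IsHomogeneousVec (fun c => F.deg p c.1 + G.deg q c.2) m (x p q)) (p q : ℕ) :
    IsHomogeneousVec (fun c => F.deg p c.1 + G.deg q c.2) m (totalDiff F G x p q) := by
  have := F.finite_gen
  have := G.finite_gen
  rw [totalDiff_apply]
  have h1 := outerLinearMap_isGradedMap (F.diff_graded p) (ψ := LinearMap.id) (d₂ := G.deg q)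
    (d₂' := G.deg q) (fun _ _ h => h) m _ (hx (p + 1) q)
  have h2 := outerLinearMap_isGradedMap (φ := LinearMap.id) (d₁ := F.deg p)
    (d₁' := F.deg p) (fun _ _ h => h) (G.diff_graded q) m _ (hx p (q + 1))
  refine h1.add ?_
  rcases neg_one_pow_eq_or ℤ p with h | h
  · rwa [h, one_smul]
  · rw [h, neg_smul, one_smul]
    exact h2.neg

theorem totalDiff_mem_idealOfVars (x : ∀ p q, Bimodule F G p q) (p q : ℕ) (c) :
    totalDiff F G x p q c ∈ idealOfVars (V₁ ⊕ V₂) K := by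
  have := F.finite_gen
  have := G.finite_gen
  rw [totalDiff_apply, Pi.add_apply]
  refine Ideal.add_mem _ (outerLinearMap_apply_mem_left (F.minimal p) _ _ _) ?_
  rw [Pi.smul_apply]
  exact zsmul_mem (outerLinearMap_apply_mem_right _ (G.minimal q) _ _) _

set_option maxRecDepth 4000 in
/-- The tensor product over `K` of minimal graded free resolutions over `K[V₁]` and `K[V₂]` is a
minimal graded free resolution over `K[V₁ ⊕ V₂]`. -/
theorem exists_tensor_resolution :
    ∃ T : MinimalGradedFreeResolution (sumIdeal I₁ I₂), ∀ i d, T.betti i d =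
      Nat.card {z : TensorGen F G i // tensorDeg F G i z = d} := by
  have := F.finite_gen
  have := G.finite_gen
  obtain ⟨ε, hε, hε'⟩ := exists_tensor_aug F G
  -- On `outer a b`, one factor becomes a boundary, whose augmentation is represented by `0`.
  have haug_diff : ∀ x, ε (totalDiff F G x 0 0) = 0 := by
    intro x
    have h1 : ∀ z, ε (outerLinearMap (F.diff 0) LinearMap.id z) = 0 := by
      intro z
      induction z using outer_induction with
      | h₀ => simp
      | hadd z z' h h' => rw [map_add, map_add, h, h', add_zero]
      | h a b =>
        obtain ⟨g, hg⟩ := Ideal.Quotient.mk_surjective (G.aug b)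
        rw [outerLinearMap_outer, LinearMap.id_apply, hε' _ _ 0 g _ hg.symm]
        · simp
        · rw [F.exact_aug.apply_apply_eq_zero, map_zero]
    have h2 : ∀ z, ε (outerLinearMap LinearMap.id (G.diff 0) z) = 0 := by
      intro z
      induction z using outer_induction with
      | h₀ => simp
      | hadd z z' h h' => rw [map_add, map_add, h, h', add_zero]
      | h a b =>
        obtain ⟨f, hf⟩ := Ideal.Quotient.mk_surjective (F.aug a)
        rw [outerLinearMap_outer, LinearMap.id_apply, hε' _ _ f 0 hf.symm]
        · simp
        · rw [G.exact_aug.apply_apply_eq_zero, map_zero]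
    rw [totalDiff_apply, map_add, map_zsmul, h1, h2, smul_zero, add_zero]
  refine ⟨{
    gen := TensorGen F G
    finite_gen := finite_tensorGen F G
    deg := tensorDeg F G
    diff := fun n => tensorRestrict F G n ∘ₗ totalDiff F G ∘ₗ tensorExtend F G (n + 1)
    aug := ε ∘ₗ LinearMap.proj 0 ∘ₗ LinearMap.proj 0 ∘ₗ tensorExtend F G 0
    diff_graded := fun n m x hx => by
      have h1 := tensorExtend_homogeneous F G hx
      have h2 := totalDiff_homogeneous F G h1
      have h3 := tensorRestrict_homogeneous F G (n := n) h2
      rw [LinearMap.comp_apply, LinearMap.comp_apply]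
      exact h3
    aug_graded := fun m x hx => hε m _ (tensorExtend_homogeneous F G hx 0 0)
    aug_surjective := ?_
    exact_aug := ?_
    exact_diff := ?_
    minimal := fun n x z => totalDiff_mem_idealOfVars F G _ _ _ _ }, fun i d => rfl⟩
  -- If `a` and `b` are sent to `1` by the augmentations, then `ε (outer a b) = 1`, and by linearity
  -- `f • outer a b` is sent to the class of `f`.
  · obtain ⟨a, ha⟩ := F.aug_surjective (Ideal.Quotient.mk I₁ 1)
    obtain ⟨b, hb⟩ := G.aug_surjective (Ideal.Quotient.mk I₂ 1)
    intro y
    obtain ⟨f, rfl⟩ := Ideal.Quotient.mk_surjective y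
    have h1 : ∀ z : Bimodule F G 0 0, ∃ x, tensorExtend F G 0 x 0 0 = z := by
      intro z
      let x : ∀ p q, Bimodule F G p q := fun p q => match p, q with
        | 0, 0 => z
        | _ + 1, _ => 0
        | 0, _ + 1 => 0
      have hx : ∀ p q, p + q ≠ 0 → x p q = 0 := by
        rintro (_ | p) (_ | q) h
        · exact absurd rfl h
        all_goals rfl
      exact ⟨tensorRestrict F G 0 x, by rw [tensorExtend_restrict F G hx]⟩
    obtain ⟨x, hx⟩ := h1 (f • outer a b)
    refine ⟨x, ?_⟩
    have h2 : ε (f • outer a b) = Ideal.Quotient.mk _ f := by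
      rw [map_smul, hε' a b 1 1 ha hb, map_one, map_one, one_mul]
      exact (map_mul (Ideal.Quotient.mk _) f 1).symm.trans (by rw [mul_one])
    rw [← h2, ← hx]
    rfl
  · intro x
    constructor
    · intro hx
      -- A chain of total degree zero is a cycle: each component of its differential comes from the
      -- positions `(p + 1, q)` and `(p, q + 1)`, where the chain is zero.
      obtain ⟨y, hy, hyx⟩ := exists_totalDiff_eq F G (n := 0) (x := tensorExtend F G 0 x)
        (fun p q h => tensorExtend_apply_of_ne F G h x) (by
          have := F.finite_gen
          have := G.finite_gen
          funext p q
          rw [totalDiff_apply, tensorExtend_apply_of_ne F G (by omega),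
            tensorExtend_apply_of_ne F G (by omega)]
          simp) hε' hx
      refine ⟨tensorRestrict F G 1 y, ?_⟩
      rw [LinearMap.comp_apply, LinearMap.comp_apply, tensorExtend_restrict F G hy, hyx,
        tensorRestrict_extend]
    · rintro ⟨y, rfl⟩
      simp only [LinearMap.comp_apply, LinearMap.proj_apply]
      rw [tensorExtend_restrict F G (totalDiff_apply_of_ne F G
        fun p q h => tensorExtend_apply_of_ne F G h y), haug_diff]
  · intro n x
    constructor
    · intro hx
      rw [LinearMap.comp_apply, LinearMap.comp_apply] at hx
      have h1 := congrArg (tensorExtend F G n) hx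
      rw [tensorExtend_restrict F G (totalDiff_apply_of_ne F G
        fun p q h => tensorExtend_apply_of_ne F G h x), map_zero] at h1
      -- The chain has total degree `n + 1`, so its component at `(0, 0)` is zero and the condition
      -- on the augmentation holds trivially.
      obtain ⟨y, hy, hyx⟩ := exists_totalDiff_eq F G
        (fun p q h => tensorExtend_apply_of_ne F G h x) h1 hε' (by
          rw [tensorExtend_apply_of_ne F G (by omega), map_zero])
      refine ⟨tensorRestrict F G (n + 2) y, ?_⟩
      rw [LinearMap.comp_apply, LinearMap.comp_apply, tensorExtend_restrict F G hy, hyx,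
        tensorRestrict_extend]
    · rintro ⟨y, rfl⟩
      simp only [LinearMap.comp_apply]
      rw [tensorExtend_restrict F G (totalDiff_apply_of_ne F G
        fun p q h => tensorExtend_apply_of_ne F G h y), totalDiff_totalDiff, map_zero]

/-- The generators of the tensor product of given homological and internal degree. -/
def tensorGenEquiv (i d : ℕ) :
    {z : TensorGen F G i // tensorDeg F G i z = d} ≃
      Σ (p : Finset.HasAntidiagonal.antidiagonal i) (r : Finset.HasAntidiagonal.antidiagonal d),
        {a : F.gen p.1.1 // F.deg _ a = r.1.1} × {b : G.gen p.1.2 // G.deg _ b = r.1.2} where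
  toFun z := ⟨⟨(z.1.1.1, z.1.1.2.1), Finset.HasAntidiagonal.mem_antidiagonal.mpr z.1.2⟩,
    ⟨(F.deg _ z.1.1.2.2.1, G.deg _ z.1.1.2.2.2), Finset.HasAntidiagonal.mem_antidiagonal.mpr z.2⟩,
    ⟨z.1.1.2.2.1, rfl⟩, ⟨z.1.1.2.2.2, rfl⟩⟩
  invFun w := ⟨⟨⟨w.1.1.1, w.1.1.2, w.2.2.1.1, w.2.2.2.1⟩,
    Finset.HasAntidiagonal.mem_antidiagonal.mp w.1.2⟩, by
    have h := Finset.HasAntidiagonal.mem_antidiagonal.mp w.2.1.2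
    exact (congrArg₂ (· + ·) w.2.2.1.2 w.2.2.2.2).trans h⟩
  left_inv z := rfl
  right_inv := by
    rintro ⟨⟨⟨p, q⟩, h⟩, ⟨⟨r, s⟩, h'⟩, ⟨a, ha⟩, ⟨b, hb⟩⟩
    dsimp only at a b ha hb
    subst ha hb
    rfl

theorem card_tensorGen (i d : ℕ) :
    Nat.card {z : TensorGen F G i // tensorDeg F G i z = d} =
      ∑ p ∈ Finset.HasAntidiagonal.antidiagonal i, ∑ r ∈ Finset.HasAntidiagonal.antidiagonal d,
        F.betti p.1 r.1 * G.betti p.2 r.2 := by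
  have := F.finite_gen
  have := G.finite_gen
  rw [Nat.card_congr (tensorGenEquiv F G i d), Nat.card_sigma,
    ← Finset.sum_coe_sort (Finset.HasAntidiagonal.antidiagonal i)]
  refine Finset.sum_congr rfl fun p _ => ?_
  rw [Nat.card_sigma, ← Finset.sum_coe_sort (Finset.HasAntidiagonal.antidiagonal d)]
  exact Finset.sum_congr rfl fun r _ => Nat.card_prod _ _

end MinimalGradedFreeResolution

/-! ### The Stanley-Reisner ideal of a join -/

theorem isFace_join_iff {Δ₁ : PreAbstractSimplicialComplex V₁}
    {Δ₂ : PreAbstractSimplicialComplex V₂} {s : Finset (V₁ ⊕ V₂)} :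
    IsFace (join Δ₁ Δ₂) s ↔ IsFace Δ₁ s.toLeft ∧ IsFace Δ₂ s.toRight := by
  constructor
  · rintro (rfl | ⟨-, F₁, F₂, h₁, h₂, rfl⟩)
    · exact ⟨Or.inl rfl, Or.inl rfl⟩
    · simpa using ⟨h₁, h₂⟩
  · rintro ⟨h₁, h₂⟩
    rcases s.eq_empty_or_nonempty with h | h
    · exact Or.inl h
    · exact Or.inr ⟨h, _, _, h₁, h₂, Finset.toLeft_disjSum_toRight.symm⟩

/-- If `s` is not a face of the join, its part in `V₁` or its part in `V₂` is not a face, and the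
monomial of that part divides the monomial of `s`. Conversely, a nonface of `Δ₁` or `Δ₂` remains a
nonface in the join, with the same monomial. -/
theorem stanleyReisnerIdeal_join (Δ₁ : PreAbstractSimplicialComplex V₁)
    (Δ₂ : PreAbstractSimplicialComplex V₂) :
    stanleyReisnerIdeal K (join Δ₁ Δ₂) =
      sumIdeal (stanleyReisnerIdeal K Δ₁) (stanleyReisnerIdeal K Δ₂) := by
  apply le_antisymm
  · rw [stanleyReisnerIdeal, Ideal.span_le]
    rintro _ ⟨s, hs, rfl⟩
    have h1 : (∏ v ∈ s, X v : MvPolynomial (V₁ ⊕ V₂) K) =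
        rename Sum.inl (∏ v ∈ s.toLeft, X v : MvPolynomial V₁ K) *
          rename Sum.inr (∏ v ∈ s.toRight, X v : MvPolynomial V₂ K) := by
      conv_lhs => rw [← Finset.toLeft_disjSum_toRight (u := s), Finset.prod_disjSum]
      simp
    rw [isFace_join_iff, not_and_or] at hs
    rw [h1]
    rcases hs with hs | hs
    · exact Ideal.mem_sup_left (Ideal.mul_mem_right _ _
        (Ideal.mem_map_of_mem _ (Ideal.subset_span ⟨_, hs, rfl⟩)))
    · exact Ideal.mem_sup_right (Ideal.mul_mem_left _ _
        (Ideal.mem_map_of_mem _ (Ideal.subset_span ⟨_, hs, rfl⟩)))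
  · refine sup_le ?_ ?_
    · rw [stanleyReisnerIdeal, Ideal.map_span, Ideal.span_le]
      rintro _ ⟨_, ⟨s, hs, rfl⟩, rfl⟩
      refine Ideal.subset_span ⟨s.disjSum ∅, fun h => hs ?_, ?_⟩
      · simpa only [Finset.toLeft_disjSum] using (isFace_join_iff.mp h).1
      · rw [Finset.prod_disjSum]; simp
    · rw [stanleyReisnerIdeal, Ideal.map_span, Ideal.span_le]
      rintro _ ⟨_, ⟨s, hs, rfl⟩, rfl⟩
      refine Ideal.subset_span ⟨Finset.disjSum ∅ s, fun h => hs ?_, ?_⟩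
      · simpa only [Finset.toRight_disjSum] using (isFace_join_iff.mp h).2
      · rw [Finset.prod_disjSum]; simp

end TensorResolution

end BettiJoin

theorem mainTheorem5 {V₁ : Type*} {V₂ : Type*} [Finite V₁] [Finite V₂] (K : Type*) [Field K]
    (Δ₁ : PreAbstractSimplicialComplex V₁) (Δ₂ : PreAbstractSimplicialComplex V₂) (i d : ℕ) :
    BettiJoin.bettiNumber K (BettiJoin.join Δ₁ Δ₂) i d =
      ∑ p ∈ Finset.HasAntidiagonal.antidiagonal i, ∑ r ∈ Finset.HasAntidiagonal.antidiagonal d,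
        BettiJoin.bettiNumber K Δ₁ p.1 r.1 * BettiJoin.bettiNumber K Δ₂ p.2 r.2 := by
  obtain ⟨F⟩ := BettiJoin.exists_resolution _
    (BettiJoin.stanleyReisnerIdeal_isHomogeneous (K := K) Δ₁)
  obtain ⟨G⟩ := BettiJoin.exists_resolution _
    (BettiJoin.stanleyReisnerIdeal_isHomogeneous (K := K) Δ₂)
  have hT := BettiJoin.MinimalGradedFreeResolution.exists_tensor_resolution F G
  rw [← BettiJoin.stanleyReisnerIdeal_join] at hT
  obtain ⟨T, hT⟩ := hT
  rw [BettiJoin.bettiNumber_eq_betti _ T, hT,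
    BettiJoin.MinimalGradedFreeResolution.card_tensorGen]
  simp only [BettiJoin.bettiNumber_eq_betti Δ₁ F, BettiJoin.bettiNumber_eq_betti Δ₂ G]
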